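/- For each integer $n \ge 1$, let $A_n$ be the number of dimer coverings (perfect matchings) of the $2n \times 2n$ square lattice graph, i.e. the number of ways to cover a $2n \times 2n$ chessboard by $2n^2$ dominoes, each covering two adjacent squares. Define $B_n > 0$ by $A_n = 2^n B_n^2$. Then every $B_n$ is an integer, and the sequence $(B_n \bmod 64)_{n \ge 1}$ is periodic with primitive period $64$: one has $B_{n+64} \equiv B_n \pmod{64}$ for all $n \ge 1$, and $64$ is the smallest positive integer $p$ such that $B_{n+p} \equiv B_n \pmod{64}$ for all $n \ge 1$. -/

import Mathlib

/-- The `2n × 2n` square lattice graph (chessboard): the vertices are the `(2n)²` cells `(i, j)`,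
and two cells are adjacent when they agree in one coordinate and are consecutive in the other. -/
def squareLattice (n : ℕ) : SimpleGraph (Fin (2 * n) × Fin (2 * n)) :=
  SimpleGraph.boxProd (SimpleGraph.pathGraph (2 * n)) (SimpleGraph.pathGraph (2 * n))

/-- `A_n`: the number of dimer coverings (perfect matchings) of the `2n × 2n` square lattice
graph. A perfect matching is a spanning subgraph in which every vertex has exactly one
neighbour. -/
noncomputable def dimerCount (n : ℕ) : ℕ :=
  Nat.card {M : (squareLattice n).Subgraph // M.IsPerfectMatching}

/-- Two cells of the quarter plane are adjacent when they share an edge. -/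
def gridAdj (x y : ℕ × ℕ) : Prop :=
  (x.1 = y.1 ∧ (x.2 + 1 = y.2 ∨ y.2 + 1 = x.2)) ∨ (x.2 = y.2 ∧ (x.1 + 1 = y.1 ∨ y.1 + 1 = x.1))

instance : DecidableRel gridAdj := fun x y => by unfold gridAdj; infer_instance

lemma gridAdj.symm {x y : ℕ × ℕ} (h : gridAdj x y) : gridAdj y x := by
  unfold gridAdj at *; omega

/-- Domino tilings of the `N × N` board, as involutions exchanging adjacent cells. -/
structure IsTiling (N : ℕ) (T : ℕ × ℕ → ℕ × ℕ) : Prop where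
  invol : ∀ x, T (T x) = x
  mem : ∀ x : ℕ × ℕ, x.1 < N → x.2 < N → (T x).1 < N ∧ (T x).2 < N
  adj : ∀ x : ℕ × ℕ, x.1 < N → x.2 < N → gridAdj x (T x)
  out : ∀ x : ℕ × ℕ, ¬ (x.1 < N ∧ x.2 < N) → T x = x

/-- The partner of a cell in the tiling by horizontal dominoes. -/
def brick (x : ℕ × ℕ) : ℕ × ℕ := (x.1, if x.2 % 2 = 0 then x.2 + 1 else x.2 - 1)

/-- The Kasteleyn weight of a pair of cells. -/
def kastWeight (x y : ℕ × ℕ) : ℤ :=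
  if gridAdj x y then if x.1 = y.1 then 1 else (-1) ^ x.2 else 0

/-- The cells of the `N × N` board of even coordinate sum. -/
def blackCells (N : ℕ) : Finset (ℕ × ℕ) :=
  (Finset.range N ×ˢ Finset.range N).filter fun x => (x.1 + x.2) % 2 = 0

lemma mem_blackCells {N : ℕ} {x : ℕ × ℕ} :
    x ∈ blackCells N ↔ x.1 < N ∧ x.2 < N ∧ (x.1 + x.2) % 2 = 0 := by
  simp [blackCells, and_assoc]

/-- The matching obtained by exchanging the partners of `p` and `q`. -/
def flipTiling (p q : ℕ × ℕ) (T : ℕ × ℕ → ℕ × ℕ) (x : ℕ × ℕ) : ℕ × ℕ :=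
  Equiv.swap p q (T (Equiv.swap p q x))

lemma gridAdj.parity {x y : ℕ × ℕ} (h : gridAdj x y) : (x.1 + x.2) % 2 ≠ (y.1 + y.2) % 2 := by
  unfold gridAdj at h; omega

lemma IsTiling.ne_of_black {N : ℕ} {T : ℕ × ℕ → ℕ × ℕ} (hT : IsTiling N T) {p q : ℕ × ℕ}
    (hp : p ∈ blackCells N) (hq : q ∈ blackCells N) : T p ≠ q := by
  rw [mem_blackCells] at hp hq
  intro h
  have := (hT.adj p hp.1 hp.2.1).parity
  rw [h] at this
  omega

lemma IsTiling.injective {N : ℕ} {T : ℕ × ℕ → ℕ × ℕ} (hT : IsTiling N T) :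
    Function.Injective T := Function.Involutive.injective hT.invol

section flip

variable {N : ℕ} {T : ℕ × ℕ → ℕ × ℕ} {p q : ℕ × ℕ}

lemma flipTiling_left (hT : IsTiling N T) (hp : p ∈ blackCells N) (hq : q ∈ blackCells N) :
    flipTiling p q T p = T q := by
  rw [flipTiling, Equiv.swap_apply_left,
    Equiv.swap_apply_of_ne_of_ne (hT.ne_of_black hq hp) (hT.ne_of_black hq hq)]

lemma flipTiling_right (hT : IsTiling N T) (hp : p ∈ blackCells N) (hq : q ∈ blackCells N) :
    flipTiling p q T q = T p := by
  rw [flipTiling, Equiv.swap_apply_right,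
    Equiv.swap_apply_of_ne_of_ne (hT.ne_of_black hp hp) (hT.ne_of_black hp hq)]

lemma flipTiling_left' (hT : IsTiling N T) (hp : p ∈ blackCells N) (hq : q ∈ blackCells N) :
    flipTiling p q T (T p) = q := by
  rw [flipTiling, Equiv.swap_apply_of_ne_of_ne (hT.ne_of_black hp hp) (hT.ne_of_black hp hq),
    hT.invol, Equiv.swap_apply_left]

lemma flipTiling_right' (hT : IsTiling N T) (hp : p ∈ blackCells N) (hq : q ∈ blackCells N) :
    flipTiling p q T (T q) = p := by
  rw [flipTiling, Equiv.swap_apply_of_ne_of_ne (hT.ne_of_black hq hp) (hT.ne_of_black hq hq),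
    hT.invol, Equiv.swap_apply_right]

lemma flipTiling_of_ne (hT : IsTiling N T) {x : ℕ × ℕ} (h1 : x ≠ p) (h2 : x ≠ q) (h3 : x ≠ T p)
    (h4 : x ≠ T q) : flipTiling p q T x = T x := by
  rw [flipTiling, Equiv.swap_apply_of_ne_of_ne h1 h2, Equiv.swap_apply_of_ne_of_ne]
  · rintro rfl; exact h3 (hT.invol x).symm
  · rintro rfl; exact h4 (hT.invol x).symm

lemma IsTiling.flip (hT : IsTiling N T) (hp : p ∈ blackCells N) (hq : q ∈ blackCells N)
    (h1 : gridAdj p (T q)) (h2 : gridAdj q (T p)) : IsTiling N (flipTiling p q T) := by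
  have hp' := mem_blackCells.1 hp
  have hq' := mem_blackCells.1 hq
  have key : ∀ x : ℕ × ℕ, x.1 < N → x.2 < N →
      ((flipTiling p q T x).1 < N ∧ (flipTiling p q T x).2 < N) ∧
        gridAdj x (flipTiling p q T x) := by
    intro x hx1 hx2
    by_cases e1 : x = p
    · subst e1
      rw [flipTiling_left hT hp hq]
      exact ⟨hT.mem _ hq'.1 hq'.2.1, h1⟩
    by_cases e2 : x = q
    · subst e2
      rw [flipTiling_right hT hp hq]
      exact ⟨hT.mem _ hp'.1 hp'.2.1, h2⟩
    by_cases e3 : x = T p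
    · subst e3
      rw [flipTiling_left' hT hp hq]
      exact ⟨⟨hq'.1, hq'.2.1⟩, h2.symm⟩
    by_cases e4 : x = T q
    · subst e4
      rw [flipTiling_right' hT hp hq]
      exact ⟨⟨hp'.1, hp'.2.1⟩, h1.symm⟩
    rw [flipTiling_of_ne hT e1 e2 e3 e4]
    exact ⟨hT.mem x hx1 hx2, hT.adj x hx1 hx2⟩
  refine ⟨fun x => ?_, fun x h h' => (key x h h').1, fun x h h' => (key x h h').2, fun x hx => ?_⟩
  · simp [flipTiling, hT.invol]
  · have hp1 := hT.mem p hp'.1 hp'.2.1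
    have hq1 := hT.mem q hq'.1 hq'.2.1
    rw [flipTiling_of_ne hT, hT.out x hx] <;> rintro rfl
    · exact hx ⟨hp'.1, hp'.2.1⟩
    · exact hx ⟨hq'.1, hq'.2.1⟩
    · exact hx hp1
    · exact hx hq1

end flip

section connectivity

variable {N : ℕ} {P : (ℕ × ℕ → ℕ × ℕ) → Prop}

/-- Closure of a property of tilings under the elementary flips, in one direction. -/
def FlipClosed (N : ℕ) (P : (ℕ × ℕ → ℕ × ℕ) → Prop) : Prop :=
  ∀ T p q, IsTiling N T → p ∈ blackCells N → q ∈ blackCells N → p ≠ q → gridAdj p (T q) →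
    gridAdj q (T p) →
    kastWeight p (T q) * kastWeight q (T p) = -(kastWeight p (T p) * kastWeight q (T q)) →
    P (flipTiling p q T) → P T

lemma neg_one_pow_succ_mul (c : ℕ) : (-1 : ℤ) ^ c * (-1) ^ (c + 1) = -1 := by
  rw [pow_succ, ← mul_assoc, ← pow_add, ← two_mul, pow_mul]; simp

lemma exists_flip_vertical (hP : FlipClosed N P) {T : ℕ × ℕ → ℕ × ℕ} (hT : IsTiling N T) {r c : ℕ}
    (hr : r + 1 < N) (hc : c + 1 < N) (h1 : T (r, c) = (r + 1, c))
    (h2 : T (r, c + 1) = (r + 1, c + 1)) :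
    ∃ T', IsTiling N T' ∧ (P T' → P T) ∧ T' (r, c) = (r, c + 1) ∧
      T' (r + 1, c) = (r + 1, c + 1) ∧
      ∀ x : ℕ × ℕ, (x.1 < r ∨ r + 1 < x.1 ∨ x.2 < c ∨ c + 1 < x.2) → T' x = T x := by
  have h3 : T (r + 1, c) = (r, c) := by rw [← h1, hT.invol]
  have h4 : T (r + 1, c + 1) = (r, c + 1) := by rw [← h2, hT.invol]
  have key : ∀ p q, p ∈ blackCells N → q ∈ blackCells N →
      ((p = (r, c) ∧ q = (r + 1, c + 1)) ∨ (p = (r + 1, c) ∧ q = (r, c + 1))) →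
      IsTiling N (flipTiling p q T) ∧ (P (flipTiling p q T) → P T) := by
    intro p q hp hq h
    have a1 : gridAdj p (T q) := by
      rcases h with ⟨rfl, rfl⟩ | ⟨rfl, rfl⟩ <;> simp [h2, h4, gridAdj]
    have a2 : gridAdj q (T p) := by
      rcases h with ⟨rfl, rfl⟩ | ⟨rfl, rfl⟩ <;> simp [h1, h3, gridAdj]
    refine ⟨hT.flip hp hq a1 a2, hP T p q hT hp hq ?_ a1 a2 ?_⟩
    · rcases h with ⟨rfl, rfl⟩ | ⟨rfl, rfl⟩ <;> simp
    · rcases h with ⟨rfl, rfl⟩ | ⟨rfl, rfl⟩ <;>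
        simp [h1, h2, h3, h4, kastWeight, gridAdj, neg_one_pow_succ_mul]
  by_cases hpar : (r + c) % 2 = 0
  · have hp : (r, c) ∈ blackCells N := mem_blackCells.2 ⟨by dsimp; omega, by dsimp; omega, hpar⟩
    have hq : (r + 1, c + 1) ∈ blackCells N :=
      mem_blackCells.2 ⟨hr, hc, by dsimp; omega⟩
    obtain ⟨k1, k2⟩ := key _ _ hp hq (Or.inl ⟨rfl, rfl⟩)
    refine ⟨_, k1, k2, ?_, ?_, fun x hx => ?_⟩
    · rw [flipTiling_left hT hp hq, h4]
    · rw [← h1, flipTiling_left' hT hp hq]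
    · apply flipTiling_of_ne hT <;> rintro rfl <;> simp [h1, h4] at hx
  · have hp : (r + 1, c) ∈ blackCells N :=
      mem_blackCells.2 ⟨hr, by dsimp; omega, by dsimp; omega⟩
    have hq : (r, c + 1) ∈ blackCells N :=
      mem_blackCells.2 ⟨by dsimp; omega, hc, by dsimp; omega⟩
    obtain ⟨k1, k2⟩ := key _ _ hp hq (Or.inr ⟨rfl, rfl⟩)
    refine ⟨_, k1, k2, ?_, ?_, fun x hx => ?_⟩
    · rw [← h3, flipTiling_left' hT hp hq]
    · rw [flipTiling_left hT hp hq, h2]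
    · apply flipTiling_of_ne hT <;> rintro rfl <;> simp [h2, h3] at hx

lemma exists_flip_horizontal (hP : FlipClosed N P) {T : ℕ × ℕ → ℕ × ℕ} (hT : IsTiling N T)
    {r c : ℕ} (hr : r + 1 < N) (hc : c + 1 < N) (h1 : T (r, c) = (r, c + 1))
    (h2 : T (r + 1, c) = (r + 1, c + 1)) :
    ∃ T', IsTiling N T' ∧ (P T' → P T) ∧ T' (r, c) = (r + 1, c) ∧
      T' (r, c + 1) = (r + 1, c + 1) ∧
      ∀ x : ℕ × ℕ, (x.1 < r ∨ r + 1 < x.1 ∨ x.2 < c ∨ c + 1 < x.2) → T' x = T x := by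
  have h3 : T (r, c + 1) = (r, c) := by rw [← h1, hT.invol]
  have h4 : T (r + 1, c + 1) = (r + 1, c) := by rw [← h2, hT.invol]
  have key : ∀ p q, p ∈ blackCells N → q ∈ blackCells N →
      ((p = (r, c) ∧ q = (r + 1, c + 1)) ∨ (p = (r, c + 1) ∧ q = (r + 1, c))) →
      IsTiling N (flipTiling p q T) ∧ (P (flipTiling p q T) → P T) := by
    intro p q hp hq h
    have a1 : gridAdj p (T q) := by
      rcases h with ⟨rfl, rfl⟩ | ⟨rfl, rfl⟩ <;> simp [h2, h4, gridAdj]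
    have a2 : gridAdj q (T p) := by
      rcases h with ⟨rfl, rfl⟩ | ⟨rfl, rfl⟩ <;> simp [h1, h3, gridAdj]
    refine ⟨hT.flip hp hq a1 a2, hP T p q hT hp hq ?_ a1 a2 ?_⟩
    · rcases h with ⟨rfl, rfl⟩ | ⟨rfl, rfl⟩ <;> simp
    · rcases h with ⟨rfl, rfl⟩ | ⟨rfl, rfl⟩ <;>
        simp [h1, h2, h3, h4, kastWeight, gridAdj, neg_one_pow_succ_mul,
          mul_comm ((-1 : ℤ) ^ (c + 1))]
  by_cases hpar : (r + c) % 2 = 0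
  · have hp : (r, c) ∈ blackCells N := mem_blackCells.2 ⟨by dsimp; omega, by dsimp; omega, hpar⟩
    have hq : (r + 1, c + 1) ∈ blackCells N :=
      mem_blackCells.2 ⟨hr, hc, by dsimp; omega⟩
    obtain ⟨k1, k2⟩ := key _ _ hp hq (Or.inl ⟨rfl, rfl⟩)
    refine ⟨_, k1, k2, ?_, ?_, fun x hx => ?_⟩
    · rw [flipTiling_left hT hp hq, h4]
    · rw [← h1, flipTiling_left' hT hp hq]
    · apply flipTiling_of_ne hT <;> rintro rfl <;> simp [h1, h4] at hx
  · have hp : (r, c + 1) ∈ blackCells N :=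
      mem_blackCells.2 ⟨by dsimp; omega, hc, by dsimp; omega⟩
    have hq : (r + 1, c) ∈ blackCells N :=
      mem_blackCells.2 ⟨hr, by dsimp; omega, by dsimp; omega⟩
    obtain ⟨k1, k2⟩ := key _ _ hp hq (Or.inr ⟨rfl, rfl⟩)
    refine ⟨_, k1, k2, ?_, ?_, fun x hx => ?_⟩
    · rw [← h3, flipTiling_left' hT hp hq]
    · rw [flipTiling_left hT hp hq, h2]
    · apply flipTiling_of_ne hT <;> rintro rfl <;> simp [h2, h3] at hx

/-- The staircase argument: a vertical domino whose right neighbour points right or down can be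
made horizontal by flips that stay weakly below and to the right of it. -/
lemma exists_horizontal_of_vertical (hP : FlipClosed N P) (k : ℕ) :
    ∀ (T : ℕ × ℕ → ℕ × ℕ) (r c : ℕ), N ≤ r + k → IsTiling N T → r + 1 < N → c + 1 < N →
      T (r, c) = (r + 1, c) → (T (r, c + 1) = (r, c + 2) ∨ T (r, c + 1) = (r + 1, c + 1)) →
      ∃ T', IsTiling N T' ∧ (P T' → P T) ∧ T' (r, c) = (r, c + 1) ∧
        ∀ x : ℕ × ℕ, (x.1 < r ∨ x.2 < c) → T' x = T x := by
  induction k with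
  | zero => intros; omega
  | succ k ih =>
    intro T r c hk hT hr hc h1 h2
    rcases h2 with h2 | h2
    · have hm := hT.mem (r, c + 1) (by dsimp; omega) (by dsimp; omega)
      rw [h2] at hm
      have hc2 : c + 2 < N := hm.2
      have h3 : T (r + 1, c) = (r, c) := by rw [← h1, hT.invol]
      have h4 : T (r, c + 2) = (r, c + 1) := by rw [← h2, hT.invol]
      -- it suffices to bring a second horizontal domino below
      have main : ∀ T₁, IsTiling N T₁ → (P T₁ → P T) →
          (∀ x : ℕ × ℕ, (x.1 < r + 1 ∨ x.2 < c + 1) → T₁ x = T x) →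
          T₁ (r + 1, c + 1) = (r + 1, c + 2) →
          ∃ T', IsTiling N T' ∧ (P T' → P T) ∧ T' (r, c) = (r, c + 1) ∧
            ∀ x : ℕ × ℕ, (x.1 < r ∨ x.2 < c) → T' x = T x := by
        intro T₁ hT₁ hPT ho hh
        obtain ⟨T₂, hT₂, hP₂, a1, a2, a3⟩ := exists_flip_horizontal hP hT₁ hr hc2
          (by rw [ho _ (Or.inl (by dsimp; omega)), h2]) hh
        obtain ⟨T₃, hT₃, hP₃, b1, b2, b3⟩ := exists_flip_vertical hP hT₂ hr hc
          (by rw [a3 _ (by dsimp; omega), ho _ (Or.inl (by dsimp; omega)), h1]) a1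
        refine ⟨T₃, hT₃, fun h => hPT (hP₂ (hP₃ h)), b1, fun x hx => ?_⟩
        rw [b3 x (by omega), a3 x (by omega), ho x (by omega)]
      have hadj := hT.adj (r + 1, c + 1) hr hc
      have hmem := hT.mem (r + 1, c + 1) hr hc
      obtain ⟨⟨u, v⟩, huv⟩ : ∃ y, T (r + 1, c + 1) = y := ⟨_, rfl⟩
      have huv' : T (u, v) = (r + 1, c + 1) := by rw [← huv, hT.invol]
      rw [huv] at hadj hmem
      simp only [gridAdj] at hadj
      have n1 : ¬ (u = r + 1 ∧ v = c) := by
        rintro ⟨rfl, rfl⟩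
        rw [h3] at huv'
        simp at huv'
      have n2 : ¬ (u = r ∧ v = c + 1) := by
        rintro ⟨rfl, rfl⟩
        rw [h2] at huv'
        simp at huv'
      have hcase : (u = r + 1 ∧ v = c + 2) ∨ (u = r + 2 ∧ v = c + 1) := by omega
      rcases hcase with ⟨rfl, rfl⟩ | ⟨rfl, rfl⟩
      · exact main T hT id (fun _ _ => rfl) huv
      · have hadj2 := hT.adj (r + 1, c + 2) hr hc2
        obtain ⟨⟨u, v⟩, huw⟩ : ∃ y, T (r + 1, c + 2) = y := ⟨_, rfl⟩
        have huw' : T (u, v) = (r + 1, c + 2) := by rw [← huw, hT.invol]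
        rw [huw] at hadj2
        simp only [gridAdj] at hadj2
        have n1 : ¬ (u = r + 1 ∧ v = c + 1) := by
          rintro ⟨rfl, rfl⟩
          rw [huv] at huw'
          simp at huw'
        have n2 : ¬ (u = r ∧ v = c + 2) := by
          rintro ⟨rfl, rfl⟩
          rw [h4] at huw'
          simp at huw'
        obtain ⟨T₁, hT₁, hPT, e1, e2⟩ := ih T (r + 1) (c + 1) (by omega) hT hmem.1 hc2 huv (by
          have hcase : (u = r + 1 ∧ v = c + 3) ∨ (u = r + 2 ∧ v = c + 2) := by omega
          rcases hcase with ⟨rfl, rfl⟩ | ⟨rfl, rfl⟩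
          · exact Or.inl huw
          · exact Or.inr huw)
        exact main T₁ hT₁ hPT e2 e1
    · obtain ⟨T', a1, a2, a3, -, a4⟩ := exists_flip_vertical hP hT hr hc h1 h2
      exact ⟨T', a1, a2, a3, fun x hx => a4 x (by omega)⟩

lemma tiling_induction_cell (hN : Even N) (hP : FlipClosed N P) {r : ℕ} (hr : r < N)
    (hnext : ∀ T, IsTiling N T →
      (∀ x : ℕ × ℕ, x.1 < r + 1 → x.2 < N → T x = brick x) → P T) (k : ℕ) :
    ∀ (T : ℕ × ℕ → ℕ × ℕ) (c : ℕ), N ≤ c + k → IsTiling N T →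
      (∀ x : ℕ × ℕ, x.1 < r → x.2 < N → T x = brick x) →
      (∀ x : ℕ × ℕ, x.1 = r → x.2 < N → x.2 < c → T x = brick x) → P T := by
  induction k with
  | zero =>
    intro T c hc hT h1 h2
    refine hnext T hT fun x hx hx' => ?_
    rcases Nat.lt_succ_iff_lt_or_eq.1 hx with h | h
    · exact h1 x h hx'
    · exact h2 x h hx' (by omega)
  | succ k ih =>
    intro T c hk hT h1 h2
    by_cases hcN : N ≤ c
    · exact ih T c (by omega) hT h1 h2
    have step : ∀ T', IsTiling N T' →
        (∀ x : ℕ × ℕ, (x.1 < r ∨ x.2 < c) → T' x = T x) → T' (r, c) = brick (r, c) → P T' := by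
      intro T' hT' ho hb
      refine ih T' (c + 1) (by omega) hT' (fun x hx hx' => by rw [ho x (Or.inl hx), h1 x hx hx'])
        fun x hx hx' hxc => ?_
      rcases Nat.lt_succ_iff_lt_or_eq.1 hxc with h | h
      · rw [ho x (Or.inr h), h2 x hx hx' h]
      · have : x = (r, c) := Prod.ext hx h
        rw [this, hb]
    by_cases hb : T (r, c) = brick (r, c)
    · exact step T hT (fun _ _ => rfl) hb
    have hc : c < N := by omega
    have hceven : c % 2 = 0 := by
      by_contra hodd
      have h3 := h2 (r, c - 1) rfl (by dsimp; omega) (by dsimp; omega)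
      have e1 : brick (r, c - 1) = (r, c) := by
        simp only [brick]
        rw [if_pos (by omega)]
        congr 1; omega
      apply hb
      rw [e1] at h3
      rw [← h3, hT.invol, h3]
      simp [brick, hodd]
    have hc1 : c + 1 < N := by
      rcases hN with ⟨t, ht⟩; omega
    have hbr : brick (r, c) = (r, c + 1) := by simp [brick, hceven]
    have hadj := hT.adj (r, c) hr hc
    have hmem := hT.mem (r, c) hr hc
    obtain ⟨⟨u, v⟩, huv⟩ : ∃ y, T (r, c) = y := ⟨_, rfl⟩
    have huv' : T (u, v) = (r, c) := by rw [← huv, hT.invol]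
    rw [huv] at hadj hmem
    simp only [gridAdj] at hadj
    have n1 : ¬ (u = r ∧ v = c + 1) := by
      rintro ⟨rfl, rfl⟩
      exact hb (huv.trans hbr.symm)
    have n2 : ¬ (u = r ∧ v + 1 = c) := by
      rintro ⟨rfl, rfl⟩
      rw [h2 _ rfl (by dsimp; omega) (by dsimp; omega), brick] at huv'
      simp at huv'
      omega
    have n3 : ¬ (u + 1 = r ∧ v = c) := by
      rintro ⟨rfl, rfl⟩
      rw [h1 _ (by dsimp; omega) (by dsimp; omega), brick] at huv'
      simp at huv'
    have hcase : u = r + 1 ∧ v = c := by omega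
    obtain ⟨rfl, rfl⟩ := hcase
    have hadj2 := hT.adj (r, v + 1) hr hc1
    obtain ⟨⟨u, w⟩, huw⟩ : ∃ y, T (r, v + 1) = y := ⟨_, rfl⟩
    have huw' : T (u, w) = (r, v + 1) := by rw [← huw, hT.invol]
    rw [huw] at hadj2
    simp only [gridAdj] at hadj2
    have n1 : ¬ (u = r ∧ w = v) := by
      rintro ⟨rfl, rfl⟩
      rw [huv] at huw'
      simp at huw'
    have n3 : ¬ (u + 1 = r ∧ w = v + 1) := by
      rintro ⟨rfl, rfl⟩
      rw [h1 _ (by dsimp; omega) (by dsimp; omega), brick] at huw'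
      simp at huw'
    obtain ⟨T', hT', hPT, e1, e2⟩ := exists_horizontal_of_vertical hP N T r v (by omega) hT hmem.1
      hc1 huv (by
        have hcase : (u = r ∧ w = v + 2) ∨ (u = r + 1 ∧ w = v + 1) := by omega
        rcases hcase with ⟨rfl, rfl⟩ | ⟨rfl, rfl⟩
        · exact Or.inl huw
        · exact Or.inr huw)
    exact hPT (step T' hT' e2 (e1.trans hbr.symm))

/-- Every domino tiling of a square of even side is connected by flips to the brick tiling. -/
theorem tiling_induction (hN : Even N) (hP : FlipClosed N P)
    (hb : ∀ T, IsTiling N T → (∀ x : ℕ × ℕ, x.1 < N → x.2 < N → T x = brick x) → P T)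
    {T : ℕ × ℕ → ℕ × ℕ} (hT : IsTiling N T) : P T := by
  have key : ∀ k r : ℕ, N ≤ r + k → ∀ T, IsTiling N T →
      (∀ x : ℕ × ℕ, x.1 < r → x.2 < N → T x = brick x) → P T := by
    intro k
    induction k with
    | zero => exact fun r hr T hT h => hb T hT fun x hx hx' => h x (by omega) hx'
    | succ k ih =>
      intro r hr T hT h
      by_cases hrN : N ≤ r
      · exact ih r (by omega) T hT h
      · exact tiling_induction_cell hN hP (by omega) (ih (r + 1) (by omega)) N T 0 (by omega) hT h
          (fun x _ _ hx => absurd hx (by omega))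
  exact key N 0 (by omega) T hT fun x hx => absurd hx (by omega)

end connectivity

lemma brick_brick (x : ℕ × ℕ) : brick (brick x) = x := by
  ext
  · rfl
  · rcases Nat.mod_two_eq_zero_or_one x.2 with h | h
    · simp [brick, h, Nat.add_mod]
    · have h1 : (x.2 - 1) % 2 = 0 := by omega
      have h2 : x.2 - 1 + 1 = x.2 := by omega
      simp [brick, h, h1, h2]

lemma gridAdj_brick (x : ℕ × ℕ) : gridAdj x (brick x) := by
  rcases Nat.mod_two_eq_zero_or_one x.2 with h | h
  · exact Or.inl ⟨rfl, Or.inl (by simp [brick, h])⟩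
  · have h2 : x.2 - 1 + 1 = x.2 := by omega
    exact Or.inl ⟨rfl, Or.inr (by simp [brick, h, h2])⟩

lemma brick_mem {N : ℕ} (hN : Even N) {x : ℕ × ℕ} (h1 : x.1 < N) (h2 : x.2 < N) :
    (brick x).1 < N ∧ (brick x).2 < N := by
  obtain ⟨k, hk⟩ := hN
  simp only [brick]; split_ifs <;> omega

section

variable {N : ℕ} {T : ℕ × ℕ → ℕ × ℕ}

lemma IsTiling.map_brick_mem (hN : Even N) (hT : IsTiling N T) {x : ℕ × ℕ}
    (hx : x ∈ blackCells N) : T (brick x) ∈ blackCells N := by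
  rw [mem_blackCells] at *
  have h1 := brick_mem hN hx.1 hx.2.1
  have h2 := hT.mem _ h1.1 h1.2
  have h3 := (hT.adj _ h1.1 h1.2).parity
  have h4 := (gridAdj_brick x).parity
  exact ⟨h2.1, h2.2, by omega⟩

lemma IsTiling.brick_map_mem (hN : Even N) (hT : IsTiling N T) {x : ℕ × ℕ}
    (hx : x ∈ blackCells N) : brick (T x) ∈ blackCells N := by
  rw [mem_blackCells] at *
  have h1 := hT.mem _ hx.1 hx.2.1
  have h2 := brick_mem hN h1.1 h1.2
  have h3 := (hT.adj _ hx.1 hx.2.1).parity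
  have h4 := (gridAdj_brick (T x)).parity
  exact ⟨h2.1, h2.2, by omega⟩

/-- The permutation of the black cells that compares a tiling with the brick tiling. -/
def tilingPerm (hN : Even N) (hT : IsTiling N T) : Equiv.Perm (blackCells N) where
  toFun b := ⟨T (brick b), hT.map_brick_mem hN b.2⟩
  invFun b := ⟨brick (T b), hT.brick_map_mem hN b.2⟩
  left_inv b := by ext1; simp [hT.invol, brick_brick]
  right_inv b := by ext1; simp [hT.invol, brick_brick]

/-- The Kasteleyn matrix, rows and columns indexed by black cells; the column of `b` stands for the
white cell `brick b`. -/
def kastMatrix (N : ℕ) : Matrix (blackCells N) (blackCells N) ℤ :=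
  Matrix.of fun b b' => kastWeight b (brick b')

lemma prod_kastMatrix_tilingPerm (hN : Even N) (hT : IsTiling N T) :
    ∏ b, kastMatrix N (tilingPerm hN hT b) b = ∏ x ∈ blackCells N, kastWeight x (T x) := by
  rw [← Finset.prod_coe_sort (blackCells N), 
    ← Equiv.prod_comp (tilingPerm hN hT) (fun b : blackCells N => kastWeight b (T b))]
  refine Finset.prod_congr rfl fun b _ => ?_
  simp [kastMatrix, tilingPerm, hT.invol]

lemma tilingPerm_flipTiling (hN : Even N) (hT : IsTiling N T) {p q : ℕ × ℕ}
    (hp : p ∈ blackCells N) (hq : q ∈ blackCells N) (hF : IsTiling N (flipTiling p q T)) :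
    tilingPerm hN hF = Equiv.swap ⟨p, hp⟩ ⟨q, hq⟩ * tilingPerm hN hT := by
  ext1 b
  have hb := mem_blackCells.1 b.2
  have h4 := (gridAdj_brick b).parity
  have h1 : brick b ≠ p := by
    intro h; have := mem_blackCells.1 hp; rw [h] at h4; omega
  have h2 : brick b ≠ q := by
    intro h; have := mem_blackCells.1 hq; rw [h] at h4; omega
  ext1
  simp only [tilingPerm, Equiv.coe_fn_mk, flipTiling, Equiv.Perm.coe_mul, Function.comp]
  rw [Equiv.swap_apply_of_ne_of_ne h1 h2]
  simp only [Equiv.swap_apply_def, Subtype.ext_iff]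
  split_ifs <;> rfl

/-- Kasteleyn's sign property. -/
theorem sign_tilingPerm_mul_prod (hN : Even N) (hT : IsTiling N T) :
    ((Equiv.Perm.sign (tilingPerm hN hT) : ℤˣ) : ℤ) *
      ∏ x ∈ blackCells N, kastWeight x (T x) = 1 := by
  have key := tiling_induction (P := fun T => ∀ hT : IsTiling N T,
    ((Equiv.Perm.sign (tilingPerm hN hT) : ℤˣ) : ℤ) *
      ∏ x ∈ blackCells N, kastWeight x (T x) = 1) hN ?_ ?_ hT
  · exact key hT
  · intro T p q hT hp hq hpq h1 h2 hw hP hT'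
    have hF := hT.flip hp hq h1 h2
    rw [← hP hF, tilingPerm_flipTiling hN hT hp hq hF, Equiv.Perm.sign_mul,
      Equiv.Perm.sign_swap (by simpa [Subtype.ext_iff] using hpq)]
    have hq' : q ∈ (blackCells N).erase p := Finset.mem_erase.2 ⟨hpq.symm, hq⟩
    have hrest : ∏ x ∈ ((blackCells N).erase p).erase q, kastWeight x (flipTiling p q T x) =
        ∏ x ∈ ((blackCells N).erase p).erase q, kastWeight x (T x) := by
      refine Finset.prod_congr rfl fun x hx => ?_
      simp only [Finset.mem_erase] at hx
      rw [flipTiling_of_ne hT hx.2.1 hx.1 (hT.ne_of_black hp hx.2.2).symm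
        (hT.ne_of_black hq hx.2.2).symm]
    rw [← Finset.mul_prod_erase _ _ hp, ← Finset.mul_prod_erase _ _ hq',
      ← Finset.mul_prod_erase _ (fun x => kastWeight x (flipTiling p q T x)) hp,
      ← Finset.mul_prod_erase _ (fun x => kastWeight x (flipTiling p q T x)) hq', hrest,
      flipTiling_left hT hp hq, flipTiling_right hT hp hq, ← mul_assoc (kastWeight p (T q)), hw]
    push_cast
    ring
  · intro T hT h hT'
    have h1 : tilingPerm hN hT' = 1 := by
      ext1 b
      ext1
      have hb := mem_blackCells.1 b.2
      have hb' := brick_mem hN hb.1 hb.2.1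
      simp only [tilingPerm, Equiv.coe_fn_mk, Equiv.Perm.coe_one, id]
      rw [h _ hb'.1 hb'.2, brick_brick]
    rw [h1, Finset.prod_eq_one]
    · simp
    · intro x hx
      have hb := mem_blackCells.1 hx
      rw [h x hb.1 hb.2.1, kastWeight, if_pos (gridAdj_brick x)]
      simp [brick]

lemma kastWeight_ne_zero {x y : ℕ × ℕ} : kastWeight x y ≠ 0 ↔ gridAdj x y := by
  unfold kastWeight
  split_ifs <;> simp_all

/-- The tiling attached to a permutation of the black cells. -/
def tilingOfPerm (σ : Equiv.Perm (blackCells N)) (x : ℕ × ℕ) : ℕ × ℕ :=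
  if h : x ∈ blackCells N then brick (σ.symm ⟨x, h⟩)
  else if h' : brick x ∈ blackCells N then σ ⟨brick x, h'⟩ else x

lemma brick_notMem_blackCells {x : ℕ × ℕ} (hx : x ∈ blackCells N) : brick x ∉ blackCells N := by
  intro h
  have := (gridAdj_brick x).parity
  rw [mem_blackCells] at hx h
  omega

lemma tilingOfPerm_brick (σ : Equiv.Perm (blackCells N)) (b : blackCells N) :
    tilingOfPerm σ (brick b) = σ b := by
  rw [tilingOfPerm, dif_neg (brick_notMem_blackCells b.2), dif_pos (by rw [brick_brick]; exact b.2)]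
  congr
  exact brick_brick _

lemma tilingOfPerm_coe (σ : Equiv.Perm (blackCells N)) (b : blackCells N) :
    tilingOfPerm σ b = brick (σ.symm b) := by
  rw [tilingOfPerm, dif_pos b.2]

lemma mem_or_exists_brick (hN : Even N) {x : ℕ × ℕ} (h1 : x.1 < N) (h2 : x.2 < N) :
    (∃ b : blackCells N, x = b) ∨ ∃ b : blackCells N, x = brick b := by
  by_cases h : (x.1 + x.2) % 2 = 0
  · exact Or.inl ⟨⟨x, mem_blackCells.2 ⟨h1, h2, h⟩⟩, rfl⟩
  · refine Or.inr ⟨⟨brick x, mem_blackCells.2 ?_⟩, (brick_brick x).symm⟩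
    have := brick_mem hN h1 h2
    have := (gridAdj_brick x).parity
    omega

lemma isTiling_tilingOfPerm (hN : Even N) {σ : Equiv.Perm (blackCells N)}
    (hσ : ∀ b, gridAdj (σ b) (brick b)) : IsTiling N (tilingOfPerm σ) := by
  have hout : ∀ x : ℕ × ℕ, ¬ (x.1 < N ∧ x.2 < N) → tilingOfPerm σ x = x := by
    intro x hx
    have h1 : x ∉ blackCells N := fun h => hx ⟨(mem_blackCells.1 h).1, (mem_blackCells.1 h).2.1⟩
    have h2 : brick x ∉ blackCells N := by
      intro h
      have := brick_mem hN (mem_blackCells.1 h).1 (mem_blackCells.1 h).2.1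
      rw [brick_brick] at this
      exact hx this
    rw [tilingOfPerm, dif_neg h1, dif_neg h2]
  refine ⟨fun x => ?_, fun x h1 h2 => ?_, fun x h1 h2 => ?_, hout⟩
  · by_cases hx : x.1 < N ∧ x.2 < N
    · rcases mem_or_exists_brick hN hx.1 hx.2 with ⟨b, rfl⟩ | ⟨b, rfl⟩
      · rw [tilingOfPerm_coe, tilingOfPerm_brick, Equiv.apply_symm_apply]
      · rw [tilingOfPerm_brick, tilingOfPerm_coe, Equiv.symm_apply_apply]
    · rw [hout x hx, hout x hx]
  · rcases mem_or_exists_brick hN h1 h2 with ⟨b, rfl⟩ | ⟨b, rfl⟩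
    · rw [tilingOfPerm_coe]
      have := mem_blackCells.1 (σ.symm b).2
      exact brick_mem hN this.1 this.2.1
    · rw [tilingOfPerm_brick]
      have := mem_blackCells.1 (σ b).2
      exact ⟨this.1, this.2.1⟩
  · rcases mem_or_exists_brick hN h1 h2 with ⟨b, rfl⟩ | ⟨b, rfl⟩
    · rw [tilingOfPerm_coe]
      simpa using hσ (σ.symm b)
    · rw [tilingOfPerm_brick]
      exact (hσ b).symm

lemma gridAdj_tilingPerm (hN : Even N) (hT : IsTiling N T) (b : blackCells N) :
    gridAdj (tilingPerm hN hT b) (brick b) := by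
  have hb := mem_blackCells.1 b.2
  have hb' := brick_mem hN hb.1 hb.2.1
  exact (hT.adj _ hb'.1 hb'.2).symm

lemma card_tilings_eq (hN : Even N) :
    Nat.card {T // IsTiling N T} =
      Nat.card {σ : Equiv.Perm (blackCells N) // ∀ b, gridAdj (σ b) (brick b)} := by
  refine Nat.card_eq_of_bijective
    (fun T => ⟨tilingPerm hN T.2, gridAdj_tilingPerm hN T.2⟩) ⟨?_, ?_⟩
  · rintro ⟨T, hT⟩ ⟨T', hT'⟩ h
    simp only [Subtype.mk.injEq] at h
    have hb : ∀ b : blackCells N, T (brick b) = T' (brick b) := fun b =>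
      congrArg Subtype.val (DFunLike.congr_fun h b)
    ext1
    funext x
    by_cases hx : x.1 < N ∧ x.2 < N
    · rcases mem_or_exists_brick hN hx.1 hx.2 with ⟨b, rfl⟩ | ⟨b, rfl⟩
      · have h1 := hb ⟨_, hT.brick_map_mem hN b.2⟩
        simp only [brick_brick, hT.invol] at h1
        have h2 := congrArg T' h1
        rw [hT'.invol] at h2
        exact h2.symm
      · exact hb b
    · exact (hT.out x hx).trans (hT'.out x hx).symm
  · rintro ⟨σ, hσ⟩
    refine ⟨⟨tilingOfPerm σ, isTiling_tilingOfPerm hN hσ⟩, ?_⟩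
    ext b : 3
    exact tilingOfPerm_brick σ b

theorem det_kastMatrix (hN : Even N) :
    (kastMatrix N).det = Nat.card {T // IsTiling N T} := by
  rw [card_tilings_eq hN, Nat.card_eq_fintype_card, Fintype.card_subtype, Matrix.det_apply]
  rw [Finset.card_filter]
  push_cast
  refine Finset.sum_congr rfl fun σ _ => ?_
  split_ifs with h
  · have hT := isTiling_tilingOfPerm hN h
    have e : tilingPerm hN hT = σ := by
      ext b : 2
      exact tilingOfPerm_brick σ b
    have := sign_tilingPerm_mul_prod hN hT
    rw [← prod_kastMatrix_tilingPerm hN hT, e] at this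
    rw [Units.smul_def, smul_eq_mul]
    exact this
  · push Not at h
    obtain ⟨b, hb⟩ := h
    rw [Finset.prod_eq_zero (Finset.mem_univ b), smul_zero]
    by_contra h0
    exact hb (kastWeight_ne_zero.1 h0)

end

lemma squareLattice_adj {n : ℕ} {u v : Fin (2 * n) × Fin (2 * n)} :
    (squareLattice n).Adj u v ↔ gridAdj (u.1, u.2) (v.1, v.2) := by
  simp only [squareLattice, SimpleGraph.boxProd_adj, SimpleGraph.pathGraph_adj, gridAdj,
    Fin.ext_iff]
  tauto

/-- The cell of the quarter plane with the coordinates of a given cell of the finite board. -/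
def cellVal {N : ℕ} (u : Fin N × Fin N) : ℕ × ℕ := (u.1, u.2)

lemma cellVal_injective {N : ℕ} : Function.Injective (cellVal (N := N)) := by
  rintro ⟨a, b⟩ ⟨c, d⟩ h
  simpa [cellVal, Fin.ext_iff] using h

lemma exists_cellVal {N : ℕ} {x : ℕ × ℕ} (h1 : x.1 < N) (h2 : x.2 < N) :
    ∃ u : Fin N × Fin N, cellVal u = x := ⟨(⟨x.1, h1⟩, ⟨x.2, h2⟩), rfl⟩

/-- The perfect matching of the square lattice attached to a tiling. -/
def tilingSubgraph {n : ℕ} {T : ℕ × ℕ → ℕ × ℕ} (hT : IsTiling (2 * n) T) :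
    (squareLattice n).Subgraph where
  verts := Set.univ
  Adj u v := T (cellVal u) = cellVal v
  adj_sub {u v} h := by
    rw [squareLattice_adj]
    have := hT.adj (cellVal u) u.1.2 u.2.2
    rwa [h] at this
  edge_vert _ := Set.mem_univ _
  symm := ⟨fun u v h => by rw [← h, hT.invol]⟩

theorem dimerCount_eq_card_tilings (n : ℕ) :
    dimerCount n = Nat.card {T // IsTiling (2 * n) T} := by
  symm
  refine Nat.card_eq_of_bijective (fun T => ⟨tilingSubgraph T.2, ?_⟩) ⟨?_, ?_⟩
  · rw [SimpleGraph.Subgraph.isPerfectMatching_iff]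
    intro v
    have hm := T.2.mem (cellVal v) v.1.2 v.2.2
    obtain ⟨u, hu⟩ := exists_cellVal hm.1 hm.2
    exact ⟨u, hu.symm, fun y hy => cellVal_injective (by rw [hu]; exact Eq.symm hy)⟩
  · rintro ⟨T, hT⟩ ⟨T', hT'⟩ h
    have h' : tilingSubgraph hT = tilingSubgraph hT' := congrArg Subtype.val h
    ext1
    funext x
    by_cases hx : x.1 < 2 * n ∧ x.2 < 2 * n
    · obtain ⟨u, rfl⟩ := exists_cellVal hx.1 hx.2
      have hm := hT.mem (cellVal u) u.1.2 u.2.2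
      obtain ⟨v, hv⟩ := exists_cellVal hm.1 hm.2
      have h1 : (tilingSubgraph hT).Adj u v := hv.symm
      rw [h'] at h1
      exact hv.symm.trans (show T' (cellVal u) = cellVal v from h1).symm
    · exact (hT.out x hx).trans (hT'.out x hx).symm
  · rintro ⟨M, hM⟩
    rw [SimpleGraph.Subgraph.isPerfectMatching_iff] at hM
    choose f hf hf' using hM
    have hff : ∀ v, f (f v) = v := fun v => (hf' _ v (hf v).symm).symm
    classical
    let T : ℕ × ℕ → ℕ × ℕ := fun x =>
      if h : x.1 < 2 * n ∧ x.2 < 2 * n then cellVal (f (⟨x.1, h.1⟩, ⟨x.2, h.2⟩)) else x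
    have hTv : ∀ u, T (cellVal u) = cellVal (f u) := fun u => dif_pos ⟨u.1.2, u.2.2⟩
    have hTo : ∀ x : ℕ × ℕ, ¬ (x.1 < 2 * n ∧ x.2 < 2 * n) → T x = x := fun x hx => dif_neg hx
    have hT : IsTiling (2 * n) T := by
      refine ⟨fun x => ?_, fun x h1 h2 => ?_, fun x h1 h2 => ?_, hTo⟩
      · by_cases hx : x.1 < 2 * n ∧ x.2 < 2 * n
        · obtain ⟨u, rfl⟩ := exists_cellVal hx.1 hx.2
          rw [hTv, hTv, hff]
        · rw [hTo x hx, hTo x hx]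
      · obtain ⟨u, rfl⟩ := exists_cellVal h1 h2
        rw [hTv]
        exact ⟨(f u).1.2, (f u).2.2⟩
      · obtain ⟨u, rfl⟩ := exists_cellVal h1 h2
        rw [hTv]
        exact squareLattice_adj.1 (hf u).adj_sub
    refine ⟨⟨T, hT⟩, Subtype.ext ?_⟩
    ext u v
    · simp only [tilingSubgraph, Set.mem_univ, true_iff]
      exact M.edge_vert (hf u)
    · change T (cellVal u) = cellVal v ↔ _
      rw [hTv]
      constructor
      · intro h
        rw [← cellVal_injective h]
        exact hf u
      · intro h
        rw [hf' u v h]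

theorem dimerCount_eq_det (n : ℕ) : (dimerCount n : ℤ) = (kastMatrix (2 * n)).det := by
  rw [det_kastMatrix (even_two_mul n), dimerCount_eq_card_tilings]

open scoped Kronecker in
lemma kronecker_sum_mul_kronecker {ι R : Type*} [Fintype ι] [DecidableEq ι] [CommRing R]
    {A V L : Matrix ι ι R} (h : A * V = V * L) :
    (1 ⊗ₖ A + A ⊗ₖ 1) * (V ⊗ₖ V) = (V ⊗ₖ V) * (1 ⊗ₖ L + L ⊗ₖ 1) := by
  simp only [add_mul, mul_add, ← Matrix.mul_kronecker_mul, one_mul, mul_one, h]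

open scoped Kronecker in
lemma det_kronecker_sum_of_mul_eq_mul_diagonal {ι R : Type*} [Fintype ι] [DecidableEq ι]
    [CommRing R] {A V : Matrix ι ι R} {l : ι → R} (hV : IsUnit V)
    (h : A * V = V * Matrix.diagonal l) :
    (1 ⊗ₖ A + A ⊗ₖ 1).det = ∏ i, ∏ j, (l i + l j) := by
  have h1 := congrArg Matrix.det (kronecker_sum_mul_kronecker h)
  have hd : (1 ⊗ₖ Matrix.diagonal l + Matrix.diagonal l ⊗ₖ 1 : Matrix (ι × ι) (ι × ι) R) =
      Matrix.diagonal fun u : ι × ι => l u.1 + l u.2 := by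
    rw [← Matrix.diagonal_one, Matrix.diagonal_kronecker_diagonal,
      Matrix.diagonal_kronecker_diagonal, Matrix.diagonal_add]
    congr 1
    funext u
    ring
  rw [Matrix.det_mul, Matrix.det_mul, mul_comm, hd, Matrix.det_diagonal,
    Fintype.prod_prod_type] at h1
  refine IsUnit.mul_left_cancel ?_ h1
  rw [Matrix.det_kronecker]
  rw [Matrix.isUnit_iff_isUnit_det] at hV
  exact (hV.pow _).mul (hV.pow _)

/-- The adjacency matrix of the path with `N` vertices. -/
def pathMatrix (N : ℕ) : Matrix (Fin N) (Fin N) ℝ :=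
  Matrix.of fun i j => if (i : ℕ) + 1 = j ∨ (j : ℕ) + 1 = i then 1 else 0

/-- The diagonal matrix of alternating signs. -/
def altMatrix (N : ℕ) : Matrix (Fin N) (Fin N) ℝ :=
  Matrix.diagonal fun i => (-1) ^ (i : ℕ)

lemma pathMatrix_mul_altMatrix (N : ℕ) :
    pathMatrix N * altMatrix N + altMatrix N * pathMatrix N = 0 := by
  ext i j
  simp only [altMatrix, Matrix.add_apply, Matrix.mul_diagonal, Matrix.diagonal_mul, pathMatrix,
    Matrix.of_apply, Matrix.zero_apply]
  split_ifs with h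
  · rcases h with h | h <;> rw [← h, pow_succ] <;> ring
  · simp

lemma altMatrix_mul_altMatrix (N : ℕ) : altMatrix N * altMatrix N = 1 := by
  rw [altMatrix, Matrix.diagonal_mul_diagonal, ← Matrix.diagonal_one]
  congr 1
  funext i
  rw [← mul_pow]; simp

open scoped Kronecker

/-- The Kasteleyn matrix on all cells of the board. -/
noncomputable def boardMatrix (N : ℕ) : Matrix (Fin N × Fin N) (Fin N × Fin N) ℝ :=
  1 ⊗ₖ pathMatrix N + pathMatrix N ⊗ₖ altMatrix N

lemma boardMatrix_mul_self (N : ℕ) :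
    boardMatrix N * boardMatrix N =
      1 ⊗ₖ (pathMatrix N * pathMatrix N) + (pathMatrix N * pathMatrix N) ⊗ₖ 1 := by
  have h := congrArg (fun M => pathMatrix N ⊗ₖ M) (pathMatrix_mul_altMatrix N)
  simp only [Matrix.kronecker_add, Matrix.kronecker_zero] at h
  simp only [boardMatrix, add_mul, mul_add, ← Matrix.mul_kronecker_mul, one_mul, mul_one,
    altMatrix_mul_altMatrix]
  rw [add_assoc, ← add_assoc (pathMatrix N ⊗ₖ (altMatrix N * pathMatrix N)),
    add_comm (pathMatrix N ⊗ₖ (altMatrix N * pathMatrix N)), h, zero_add]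

lemma boardMatrix_apply {N : ℕ} (u v : Fin N × Fin N) :
    boardMatrix N u v = (kastWeight (cellVal u) (cellVal v) : ℝ) := by
  obtain ⟨i, j⟩ := u
  obtain ⟨k, l⟩ := v
  simp only [boardMatrix, Matrix.add_apply, Matrix.kronecker_apply, altMatrix, pathMatrix,
    Matrix.of_apply, kastWeight, cellVal, gridAdj, Matrix.one_apply, Matrix.diagonal_apply,
    Fin.ext_iff]
  by_cases h1 : (i : ℕ) = k
  · have : ¬ ((i : ℕ) + 1 = k ∨ (k : ℕ) + 1 = i) := by omega
    simp [h1]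
  · by_cases h2 : (j : ℕ) = l
    · have : ¬ ((j : ℕ) + 1 = l ∨ (l : ℕ) + 1 = j) := by omega
      simp [h1, h2]
    · simp [h1, h2]

lemma kastWeight_comm (x y : ℕ × ℕ) : kastWeight x y = kastWeight y x := by
  have h : gridAdj x y ↔ gridAdj y x := ⟨gridAdj.symm, gridAdj.symm⟩
  unfold kastWeight
  by_cases h1 : gridAdj x y
  · rw [if_pos h1, if_pos (h.1 h1)]
    by_cases h2 : x.1 = y.1
    · rw [if_pos h2, if_pos h2.symm]
    · have : x.2 = y.2 := by
        unfold gridAdj at h1; omega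
      rw [if_neg h2, if_neg (Ne.symm h2), this]
  · rw [if_neg h1, if_neg (fun h2 => h1 (h.2 h2))]

/-- The cells of the board, listed as the black cells and their brick partners. -/
def blackSumMap {N : ℕ} (hN : Even N) : blackCells N ⊕ blackCells N → Fin N × Fin N
  | Sum.inl b => (⟨b.1.1, (mem_blackCells.1 b.2).1⟩, ⟨b.1.2, (mem_blackCells.1 b.2).2.1⟩)
  | Sum.inr b =>
    have h := brick_mem hN (mem_blackCells.1 b.2).1 (mem_blackCells.1 b.2).2.1
    (⟨(brick b).1, h.1⟩, ⟨(brick b).2, h.2⟩)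

lemma blackSumMap_bijective {N : ℕ} (hN : Even N) : Function.Bijective (blackSumMap hN) := by
  have hl : ∀ b, cellVal (blackSumMap hN (Sum.inl b)) = b := fun _ => rfl
  have hr : ∀ b, cellVal (blackSumMap hN (Sum.inr b)) = brick b := fun _ => rfl
  constructor
  · rintro (a | a) (b | b) h <;> replace h := congrArg cellVal h <;>
      simp only [hl, hr] at h
    · rw [Subtype.ext h]
    · exact absurd (h ▸ a.2) (brick_notMem_blackCells b.2)
    · exact absurd (h ▸ b.2) (brick_notMem_blackCells a.2)
    · have := congrArg brick h
      rw [brick_brick, brick_brick] at this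
      rw [Subtype.ext this]
  · intro u
    rcases mem_or_exists_brick hN (x := cellVal u) u.1.2 u.2.2 with ⟨b, hb⟩ | ⟨b, hb⟩
    · exact ⟨Sum.inl b, cellVal_injective hb.symm⟩
    · exact ⟨Sum.inr b, cellVal_injective hb.symm⟩

/-- The bijection between two copies of the black cells and the board. -/
noncomputable def blackSumEquiv {N : ℕ} (hN : Even N) :
    blackCells N ⊕ blackCells N ≃ Fin N × Fin N :=
  Equiv.ofBijective _ (blackSumMap_bijective hN)

lemma cellVal_blackSumEquiv_inl {N : ℕ} (hN : Even N) (b : blackCells N) :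
    cellVal (blackSumEquiv hN (Sum.inl b)) = b := rfl

lemma cellVal_blackSumEquiv_inr {N : ℕ} (hN : Even N) (b : blackCells N) :
    cellVal (blackSumEquiv hN (Sum.inr b)) = brick b := rfl

lemma boardMatrix_submatrix {N : ℕ} (hN : Even N) :
    (boardMatrix N).submatrix (blackSumEquiv hN) (blackSumEquiv hN) =
      Matrix.fromBlocks 0 ((kastMatrix N).map (Int.cast : ℤ → ℝ))
        ((kastMatrix N).map (Int.cast : ℤ → ℝ)).transpose 0 := by
  have h0 : ∀ x y : ℕ × ℕ, (x.1 + x.2) % 2 = (y.1 + y.2) % 2 → kastWeight x y = 0 := by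
    intro x y h
    by_contra hne
    exact (kastWeight_ne_zero.1 hne).parity h
  ext (a | a) (b | b)
  · have ha := mem_blackCells.1 a.2
    have hb := mem_blackCells.1 b.2
    simp only [Matrix.submatrix_apply, boardMatrix_apply, cellVal_blackSumEquiv_inl,
      Matrix.fromBlocks_apply₁₁, Matrix.zero_apply]
    rw [h0 _ _ (by omega), Int.cast_zero]
  · simp [boardMatrix_apply, cellVal_blackSumEquiv_inl, cellVal_blackSumEquiv_inr, kastMatrix]
  · simp [boardMatrix_apply, cellVal_blackSumEquiv_inl, cellVal_blackSumEquiv_inr, kastMatrix,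
      kastWeight_comm]
  · have ha := mem_blackCells.1 a.2
    have hb := mem_blackCells.1 b.2
    have ha' := (gridAdj_brick a).parity
    have hb' := (gridAdj_brick b).parity
    simp only [Matrix.submatrix_apply, boardMatrix_apply, cellVal_blackSumEquiv_inr,
      Matrix.fromBlocks_apply₂₂, Matrix.zero_apply]
    rw [h0 _ _ (by omega), Int.cast_zero]

lemma det_boardMatrix_mul_self {N : ℕ} (hN : Even N) :
    (boardMatrix N * boardMatrix N).det = ((kastMatrix N).det : ℝ) ^ 4 := by
  have hK : ((kastMatrix N).map (Int.cast : ℤ → ℝ)).det = ((kastMatrix N).det : ℝ) :=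
    ((Int.castRingHom ℝ).map_det (kastMatrix N)).symm
  rw [← Matrix.det_submatrix_equiv_self (blackSumEquiv hN),
    ← Matrix.submatrix_mul_equiv _ _ _ (blackSumEquiv hN), boardMatrix_submatrix,
    Matrix.fromBlocks_multiply]
  simp only [Matrix.zero_mul, Matrix.mul_zero, zero_add, add_zero, Matrix.det_fromBlocks_zero₂₁,
    Matrix.det_mul, Matrix.det_transpose, hK]
  ring

/-- The eigenvalues of the path with `N` vertices. -/
noncomputable def pathEigenvalue (N : ℕ) (j : Fin N) : ℝ :=
  2 * Real.cos (((j : ℕ) + 1) * (Real.pi / (N + 1)))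

/-- The eigenvectors of the path with `N` vertices, as the columns of a matrix. -/
noncomputable def sineMatrix (N : ℕ) : Matrix (Fin N) (Fin N) ℝ :=
  Matrix.of fun i j => Real.sin (((i : ℕ) + 1) * (((j : ℕ) + 1) * (Real.pi / (N + 1))))

lemma pathMatrix_mul_sineMatrix (N : ℕ) :
    pathMatrix N * sineMatrix N = sineMatrix N * Matrix.diagonal (pathEigenvalue N) := by
  ext i j
  rw [Matrix.mul_diagonal, Matrix.mul_apply]
  set θ : ℝ := ((j : ℕ) + 1) * (Real.pi / (N + 1)) with hθ
  simp only [pathMatrix, sineMatrix, Matrix.of_apply, pathEigenvalue, ← hθ]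
  have hend : Real.sin ((N + 1) * θ) = 0 := by
    have : (N + 1) * θ = ((j : ℕ) + 1 : ℕ) * Real.pi := by
      rw [hθ]; push_cast; field_simp
    rw [this]; exact Real.sin_nat_mul_pi _
  rw [Fin.sum_univ_eq_sum_range (fun k : ℕ =>
    (if (i : ℕ) + 1 = k ∨ k + 1 = i then (1 : ℝ) else 0) * Real.sin (((k : ℕ) + 1) * θ)) N]
  have hsplit : ∀ k ∈ Finset.range N,
      (if (i : ℕ) + 1 = k ∨ k + 1 = i then (1 : ℝ) else 0) * Real.sin (((k : ℕ) + 1) * θ) =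
      (if (i : ℕ) + 1 = k then Real.sin (((k : ℕ) + 1) * θ) else 0) +
        (if (i : ℕ) = k + 1 then Real.sin (((k : ℕ) + 1) * θ) else 0) := by
    intro k _
    by_cases h1 : (i : ℕ) + 1 = k
    · have : ¬ (i : ℕ) = k + 1 := by omega
      simp [h1, this]
    · simp [h1, eq_comm]
  rw [Finset.sum_congr rfl hsplit, Finset.sum_add_distrib, Finset.sum_ite_eq]
  have e1 : (if (i : ℕ) + 1 ∈ Finset.range N then
      Real.sin ((((i : ℕ) + 1 : ℕ) + 1) * θ) else 0) = Real.sin ((((i : ℕ) + 1 : ℕ) + 1) * θ) := by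
    split_ifs with h
    · rfl
    · have : (i : ℕ) + 1 = N := by
        have := i.2
        rw [Finset.mem_range] at h
        omega
      rw [this, hend]
  have e2 : ∑ k ∈ Finset.range N,
      (if (i : ℕ) = k + 1 then Real.sin (((k : ℕ) + 1) * θ) else 0) = Real.sin (i * θ) := by
    obtain h | ⟨t, ht⟩ : (i : ℕ) = 0 ∨ ∃ t, (i : ℕ) = t + 1 := by
      rcases (i : ℕ) with _ | t
      · exact Or.inl rfl
      · exact Or.inr ⟨t, rfl⟩
    · rw [h]
      simp
    · have : t < N := by have := i.2; omega
      simp [ht, this]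
  rw [e1, e2]
  push_cast
  have f1 : ((i : ℕ) + 1 + 1 : ℝ) * θ = ((i : ℕ) + 1) * θ + θ := by ring
  have f2 : ((i : ℕ) : ℝ) * θ = ((i : ℕ) + 1) * θ - θ := by ring
  rw [f1, f2, Real.sin_add, Real.sin_sub]
  ring

lemma isUnit_sineMatrix (N : ℕ) : IsUnit (sineMatrix N) := by
  rw [← Matrix.linearIndependent_cols_iff_isUnit]
  have hpos : (0 : ℝ) < N + 1 := by positivity
  have hang : ∀ j : Fin N, ((j : ℕ) + 1) * (Real.pi / (N + 1)) ∈ Set.Ioo 0 Real.pi := by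
    intro j
    have hj : ((j : ℕ) + 1 : ℝ) < N + 1 := by exact_mod_cast Nat.succ_lt_succ j.2
    refine ⟨by positivity, ?_⟩
    rw [← mul_div_assoc, div_lt_iff₀ hpos, mul_comm]
    exact mul_lt_mul_of_pos_left hj Real.pi_pos
  refine Module.End.eigenvectors_linearIndependent' (Matrix.toLin' (pathMatrix N))
    (pathEigenvalue N) ?_ _ fun j => ?_
  · intro a b h
    simp only [pathEigenvalue] at h
    have h' := Real.injOn_cos (Set.Ioo_subset_Icc_self (hang a)) (Set.Ioo_subset_Icc_self (hang b))
      (mul_left_cancel₀ two_ne_zero h)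
    have := mul_right_cancel₀ (by positivity) h'
    ext
    exact_mod_cast add_right_cancel this
  · rw [Module.End.hasEigenvector_iff, Module.End.mem_eigenspace_iff]
    constructor
    · ext i
      have := congrFun (congrFun (pathMatrix_mul_sineMatrix N) i) j
      rw [Matrix.mul_diagonal] at this
      simpa [Matrix.toLin'_apply, Matrix.mulVec, dotProduct, Matrix.mul_apply, mul_comm] using this
    · intro h0
      have h1 := congrFun h0 ⟨0, j.pos⟩
      simp only [Matrix.col_apply, sineMatrix, Matrix.of_apply, Pi.zero_apply] at h1
      simp only [Nat.cast_zero, zero_add, one_mul] at h1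
      exact (Real.sin_pos_of_mem_Ioo (hang j)).ne' h1

theorem det_kastMatrix_pow_four {N : ℕ} (hN : Even N) :
    ((kastMatrix N).det : ℝ) ^ 4 =
      ∏ i, ∏ j, (pathEigenvalue N i ^ 2 + pathEigenvalue N j ^ 2) := by
  rw [← det_boardMatrix_mul_self hN, boardMatrix_mul_self]
  refine det_kronecker_sum_of_mul_eq_mul_diagonal (isUnit_sineMatrix N) ?_
  rw [Matrix.mul_assoc, pathMatrix_mul_sineMatrix, ← Matrix.mul_assoc, pathMatrix_mul_sineMatrix,
    Matrix.mul_assoc, Matrix.diagonal_mul_diagonal]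
  simp only [sq]

/-- The numbers `2 cos (2πk / (2n+1))`. -/
noncomputable def cosSeq (n : ℕ) (z : ℤ) : ℝ := 2 * Real.cos (z * (2 * Real.pi / (2 * n + 1)))

lemma cosSeq_zero (n : ℕ) : cosSeq n 0 = 2 := by simp [cosSeq]

lemma cosSeq_neg (n : ℕ) (z : ℤ) : cosSeq n (-z) = cosSeq n z := by
  simp [cosSeq]

lemma cosSeq_add_mul (n : ℕ) (z k : ℤ) : cosSeq n (z + (2 * n + 1 : ℕ) * k) = cosSeq n z := by
  have h : ((z + (2 * n + 1 : ℕ) * k : ℤ) : ℝ) * (2 * Real.pi / (2 * n + 1)) =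
      z * (2 * Real.pi / (2 * n + 1)) + k * (2 * Real.pi) := by
    have : (2 * n + 1 : ℝ) ≠ 0 := by positivity
    push_cast
    field_simp
  rw [cosSeq, h, Real.cos_add_int_mul_two_pi, cosSeq]

lemma cosSeq_add_add_cosSeq_sub (n : ℕ) (a c : ℤ) :
    cosSeq n (a + c) + cosSeq n (a - c) = cosSeq n a * cosSeq n c := by
  simp only [cosSeq]
  push_cast
  rw [add_mul, sub_mul, Real.cos_add, Real.cos_sub]
  ring

/-- `cosSeq` as a function on residues. -/
noncomputable def cosRes (n : ℕ) (a : ZMod (2 * n + 1)) : ℝ := cosSeq n a.val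

lemma cosRes_intCast (n : ℕ) (z : ℤ) : cosRes n z = cosSeq n z := by
  rw [cosRes, ZMod.val_intCast]
  conv_rhs => rw [← Int.emod_add_mul_ediv z (2 * n + 1 : ℕ)]
  rw [cosSeq_add_mul]

lemma cosRes_add_add_cosRes_sub (n : ℕ) (a c : ZMod (2 * n + 1)) :
    cosRes n (a + c) + cosRes n (a - c) = cosRes n a * cosRes n c := by
  obtain ⟨a, rfl⟩ := ZMod.intCast_surjective a
  obtain ⟨c, rfl⟩ := ZMod.intCast_surjective c
  rw [← Int.cast_add, ← Int.cast_sub]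
  simp only [cosRes_intCast, cosSeq_add_add_cosSeq_sub]

lemma cosRes_two_mul (n : ℕ) (a : ZMod (2 * n + 1)) :
    cosRes n a ^ 2 = 2 + cosRes n (2 * a) := by
  rw [sq, ← cosRes_add_add_cosRes_sub, sub_self, ← two_mul a, add_comm]
  congr 1
  simp [cosRes, cosSeq_zero]

lemma two_mul_injective (n : ℕ) :
    Function.Injective fun a : ZMod (2 * n + 1) => 2 * a := by
  intro a b h
  have h2 : ((n : ZMod (2 * n + 1)) + 1) * 2 = 1 := by
    have := ZMod.natCast_self (2 * n + 1)
    push_cast at this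
    linear_combination this
  have := congrArg (fun x => ((n : ZMod (2 * n + 1)) + 1) * x) h
  simpa [← mul_assoc, h2] using this

lemma prod_residue_pairs (n : ℕ) :
    ∏ a, ∏ c, (4 + cosRes n a * cosRes n c) = ∏ a, ∏ c, (4 + cosRes n a + cosRes n c) := by
  rw [← Fintype.prod_prod_type', ← Fintype.prod_prod_type']
  let φ : ZMod (2 * n + 1) × ZMod (2 * n + 1) → ZMod (2 * n + 1) × ZMod (2 * n + 1) :=
    fun p => (p.1 + p.2, p.1 - p.2)
  have hφ : Function.Injective φ := by
    rintro ⟨a, b⟩ ⟨c, d⟩ h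
    simp only [φ, Prod.mk.injEq] at h
    have h1 : a = c := two_mul_injective n (by dsimp only; linear_combination h.1 + h.2)
    refine Prod.ext h1 (two_mul_injective n ?_)
    dsimp only
    linear_combination h.1 - h.2
  rw [← (Equiv.ofBijective φ (Finite.injective_iff_bijective.1 hφ)).prod_comp
    (fun p => 4 + cosRes n p.1 + cosRes n p.2)]
  refine Finset.prod_congr rfl fun p _ => ?_
  rw [← cosRes_add_add_cosRes_sub, add_assoc]
  rfl

lemma prod_range_two_mul_cosSeq (n : ℕ) (F : ℝ → ℝ) :
    ∏ k ∈ Finset.range (2 * n), F (cosSeq n (k + 1 : ℕ)) =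
      (∏ k ∈ Finset.range n, F (cosSeq n (k + 1 : ℕ))) ^ 2 := by
  rw [two_mul, Finset.prod_range_add, sq]
  congr 1
  rw [← Finset.prod_range_reflect]
  refine Finset.prod_congr rfl fun k hk => ?_
  rw [Finset.mem_range] at hk
  congr 1
  rw [← cosSeq_neg, ← cosSeq_add_mul n _ 1]
  congr 1
  omega

/-- The numbers `2 cos (2πk / (2n+1))`, `k = 1, …, n`. -/
noncomputable def cosFam (n : ℕ) (i : Fin n) : ℝ := cosSeq n ((i : ℕ) + 1 : ℕ)

lemma prod_cosFam (n : ℕ) (F : ℝ → ℝ) :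
    ∏ i, F (cosFam n i) = ∏ k ∈ Finset.range n, F (cosSeq n (k + 1 : ℕ)) :=
  Fin.prod_univ_eq_prod_range (fun k => F (cosSeq n (k + 1 : ℕ))) n

lemma prod_cosRes (n : ℕ) (F : ℝ → ℝ) :
    ∏ a, F (cosRes n a) = F 2 * (∏ i, F (cosFam n i)) ^ 2 := by
  have h : ∏ a : ZMod (2 * n + 1), F (cosRes n a) =
      ∏ k ∈ Finset.range (2 * n + 1), F (cosSeq n k) :=
    Fin.prod_univ_eq_prod_range (fun k : ℕ => F (cosSeq n k)) (2 * n + 1)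
  rw [h, Finset.prod_range_succ', prod_range_two_mul_cosSeq, prod_cosFam, mul_comm]
  simp [cosSeq_zero]

lemma abs_cosFam_lt (n : ℕ) (i : Fin n) : |cosFam n i| < 2 := by
  have hn : (0 : ℝ) < 2 * n + 1 := by positivity
  have hi : ((i : ℕ) + 1 : ℝ) ≤ n := by exact_mod_cast i.2
  have h0 : (0 : ℝ) < (i : ℕ) + 1 := by positivity
  set x : ℝ := ((i : ℕ) + 1) * (2 * Real.pi / (2 * n + 1)) with hx
  have hc : cosFam n i = 2 * Real.cos x := by simp [cosFam, cosSeq, hx]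
  have hx0 : 0 < x := by positivity
  have hx1 : x < Real.pi := by
    rw [hx, ← mul_div_assoc, div_lt_iff₀ hn]
    nlinarith [Real.pi_pos]
  have h1 := Real.cos_lt_cos_of_nonneg_of_le_pi le_rfl hx1.le hx0
  have h2 := Real.cos_lt_cos_of_nonneg_of_le_pi hx0.le le_rfl hx1
  rw [Real.cos_zero] at h1
  rw [Real.cos_pi] at h2
  rw [hc, abs_lt]
  constructor <;> linarith

lemma prod_four_add_sq (n : ℕ) :
    ∏ i, (4 + cosFam n i ^ 2) = ∏ i, (6 + cosFam n i) := by
  have h1 := prod_cosRes n (fun x => 4 + x ^ 2)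
  have h2 := prod_cosRes n (fun x => 6 + x)
  have h3 : ∏ a, (4 + cosRes n a ^ 2) = ∏ a, (6 + cosRes n a) := by
    rw [← (Equiv.ofBijective _ (Finite.injective_iff_bijective.1
      (two_mul_injective n))).prod_comp (fun a => 6 + cosRes n a)]
    refine Finset.prod_congr rfl fun a _ => ?_
    rw [cosRes_two_mul, Equiv.ofBijective_apply]
    ring
  rw [h3, h2] at h1
  norm_num at h1
  have p1 : 0 ≤ ∏ i, (4 + cosFam n i ^ 2) := Finset.prod_nonneg fun i _ => by positivity
  have p2 : 0 ≤ ∏ i, (6 + cosFam n i) := Finset.prod_nonneg fun i _ => by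
    have := (abs_lt.1 (abs_cosFam_lt n i)).1; linarith
  exact ((sq_eq_sq₀ p2 p1).1 h1).symm

lemma prod_pairs_relation (n : ℕ) :
    (∏ i, (4 + 2 * cosFam n i)) * ∏ i, ∏ j, (4 + cosFam n i * cosFam n j) =
      (∏ i, (6 + cosFam n i)) * ∏ i, ∏ j, (4 + cosFam n i + cosFam n j) := by
  have h := prod_residue_pairs n
  have e1 : ∀ x : ℝ, ∏ c, (4 + x * cosRes n c) = (4 + 2 * x) * (∏ j, (4 + x * cosFam n j)) ^ 2 :=
    fun x => by rw [prod_cosRes n (fun y => 4 + x * y), mul_comm x]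
  have e2 : ∀ x : ℝ, ∏ c, (4 + x + cosRes n c) = (6 + x) * (∏ j, (4 + x + cosFam n j)) ^ 2 :=
    fun x => by rw [prod_cosRes n (fun y => 4 + x + y)]; ring
  simp only [e1, e2] at h
  rw [prod_cosRes n (fun x => (4 + 2 * x) * (∏ j, (4 + x * cosFam n j)) ^ 2),
    prod_cosRes n (fun x => (6 + x) * (∏ j, (4 + x + cosFam n j)) ^ 2)] at h
  have e3 : ∏ j, (4 + 2 + cosFam n j) = ∏ j, (6 + cosFam n j) := by norm_num
  rw [Finset.prod_mul_distrib, Finset.prod_mul_distrib, Finset.prod_pow, Finset.prod_pow, e3] at h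
  have hb := fun i => abs_lt.1 (abs_cosFam_lt n i)
  have p1 : 0 ≤ ∏ i, (4 + 2 * cosFam n i) := Finset.prod_nonneg fun i _ => by linarith [hb i]
  have p2 : 0 ≤ ∏ i, (6 + cosFam n i) := Finset.prod_nonneg fun i _ => by linarith [hb i]
  have p3 : 0 ≤ ∏ i, ∏ j, (4 + cosFam n i + cosFam n j) :=
    Finset.prod_nonneg fun i _ => Finset.prod_nonneg fun j _ => by linarith [hb i, hb j]
  have p4 : 0 ≤ ∏ i, ∏ j, (4 + cosFam n i * cosFam n j) :=
    Finset.prod_nonneg fun i _ => Finset.prod_nonneg fun j _ => by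
      nlinarith [hb i, hb j, sq_nonneg (cosFam n i + cosFam n j), sq_abs (cosFam n i),
        sq_abs (cosFam n j), abs_cosFam_lt n i, abs_cosFam_lt n j, abs_nonneg (cosFam n i),
        abs_nonneg (cosFam n j)]
  have h4 : ((∏ i, (4 + 2 * cosFam n i)) * ∏ i, ∏ j, (4 + cosFam n i * cosFam n j)) ^ 4 =
      ((∏ i, (6 + cosFam n i)) * ∏ i, ∏ j, (4 + cosFam n i + cosFam n j)) ^ 4 := by
    linear_combination h / 8
  exact (pow_left_inj₀ (by positivity) (by positivity) (by norm_num)).1 h4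

/-- Kasteleyn's formula for the square board of side `2n`. -/
theorem dimerCount_eq_prod (n : ℕ) :
    (dimerCount n : ℝ) = ∏ i, ∏ j, (4 + cosFam n i + cosFam n j) := by
  have h := det_kastMatrix_pow_four (even_two_mul n)
  rw [← dimerCount_eq_det] at h
  have hl : ∀ i : Fin (2 * n), pathEigenvalue (2 * n) i ^ 2 = 2 + cosSeq n ((i : ℕ) + 1 : ℕ) := by
    intro i
    rw [pathEigenvalue, mul_pow, Real.cos_sq, cosSeq]
    push_cast
    have : 2 * (((i : ℕ) + 1) * (Real.pi / (2 * n + 1))) =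
      ((i : ℕ) + 1 : ℝ) * (2 * Real.pi / (2 * n + 1)) := by ring
    rw [this]
    ring
  have hF : ∀ F : ℝ → ℝ, ∏ i : Fin (2 * n), F (cosSeq n ((i : ℕ) + 1 : ℕ)) =
      (∏ i, F (cosFam n i)) ^ 2 := fun F => by
    rw [Fin.prod_univ_eq_prod_range (fun k => F (cosSeq n (k + 1 : ℕ))), prod_cosFam,
      prod_range_two_mul_cosSeq]
  simp only [hl] at h
  have e : ∀ x : ℝ, ∏ j : Fin (2 * n), (2 + x + (2 + cosSeq n ((j : ℕ) + 1 : ℕ))) =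
      (∏ j, (4 + x + cosFam n j)) ^ 2 := fun x => by
    rw [hF (fun y => 2 + x + (2 + y))]
    congr 1
    exact Finset.prod_congr rfl fun _ _ => by ring
  simp only [e] at h
  rw [hF (fun x => (∏ j, (4 + x + cosFam n j)) ^ 2), Finset.prod_pow, ← pow_mul] at h
  have hb := fun i => abs_lt.1 (abs_cosFam_lt n i)
  have p3 : 0 ≤ ∏ i, ∏ j, (4 + cosFam n i + cosFam n j) :=
    Finset.prod_nonneg fun i _ => Finset.prod_nonneg fun j _ => by linarith [hb i, hb j]
  push_cast at h
  exact (pow_left_inj₀ (by positivity) p3 (by norm_num)).1 h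

open Polynomial

/-- The monic integer polynomials with roots `2 cos (2πk / (2n+1))`, `k = 1, …, n`. -/
noncomputable def cosPoly : ℕ → ℤ[X]
  | 0 => 1
  | 1 => X + 1
  | n + 2 => X * cosPoly (n + 1) - cosPoly n

lemma cosPoly_monic_natDegree (n : ℕ) : (cosPoly n).Monic ∧ (cosPoly n).natDegree = n := by
  induction n using Nat.twoStepInduction with
  | zero => simp [cosPoly]
  | one =>
    rw [cosPoly, ← C_1]
    exact ⟨monic_X_add_C 1, natDegree_X_add_C 1⟩
  | more n ih1 ih2 =>
    have hm : (X * cosPoly (n + 1)).Monic := monic_X.mul ih2.1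
    have hd : (X * cosPoly (n + 1)).natDegree = n + 2 := by
      rw [monic_X.natDegree_mul ih2.1, natDegree_X, ih2.2]; ring
    have hlt : (cosPoly n).natDegree < (X * cosPoly (n + 1)).natDegree := by
      rw [ih1.2, hd]; omega
    rw [cosPoly]
    exact ⟨hm.sub_of_left (degree_lt_degree hlt), by rw [natDegree_sub_eq_left_of_natDegree_lt hlt, hd]⟩

lemma sin_mul_aeval_cosPoly (φ : ℝ) (n : ℕ) :
    Real.sin φ * aeval (2 * Real.cos (2 * φ)) (cosPoly n) = Real.sin ((2 * n + 1) * φ) := by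
  induction n using Nat.twoStepInduction with
  | zero => simp [cosPoly]
  | one =>
    have h : (2 * ((1 : ℕ) : ℝ) + 1) * φ = 3 * φ := by norm_num
    rw [h, Real.sin_three_mul, Real.cos_two_mul, cosPoly]
    simp only [map_add, aeval_X, map_one]
    linear_combination 4 * Real.sin φ * Real.sin_sq_add_cos_sq φ
  | more n ih1 ih2 =>
    rw [cosPoly, map_sub, map_mul, aeval_X, mul_sub, mul_left_comm, ih1, ih2]
    push_cast
    have e1 : (2 * ((n : ℝ) + 2) + 1) * φ = (2 * (n + 1) + 1) * φ + 2 * φ := by ring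
    have e2 : (2 * (n : ℝ) + 1) * φ = (2 * (n + 1) + 1) * φ - 2 * φ := by ring
    rw [e1, e2, Real.sin_add, Real.sin_sub]
    ring

lemma aeval_cosFam (n : ℕ) (i : Fin n) : aeval (cosFam n i) (cosPoly n) = 0 := by
  have hn : (0 : ℝ) < 2 * n + 1 := by positivity
  set φ : ℝ := ((i : ℕ) + 1) * (Real.pi / (2 * n + 1)) with hφ
  have h := sin_mul_aeval_cosPoly φ n
  have h1 : (2 * n + 1) * φ = ((i : ℕ) + 1 : ℕ) * Real.pi := by
    rw [hφ]; push_cast; field_simp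
  have h2 : 2 * Real.cos (2 * φ) = cosFam n i := by
    rw [cosFam, cosSeq, hφ]
    congr 2
    push_cast
    ring
  rw [h1, Real.sin_nat_mul_pi, h2] at h
  refine (mul_eq_zero.1 h).resolve_left (Real.sin_pos_of_pos_of_lt_pi (by positivity) ?_).ne'
  have hi : ((i : ℕ) + 1 : ℝ) ≤ n := by exact_mod_cast i.2
  rw [hφ, ← mul_div_assoc, div_lt_iff₀ hn]
  nlinarith [Real.pi_pos]

lemma cosFam_injective (n : ℕ) : Function.Injective (cosFam n) := by
  have hn : (0 : ℝ) < 2 * n + 1 := by positivity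
  have hang : ∀ i : Fin n, ((i : ℕ) + 1) * (2 * Real.pi / (2 * n + 1)) ∈ Set.Icc 0 Real.pi := by
    intro i
    have hi : ((i : ℕ) + 1 : ℝ) ≤ n := by exact_mod_cast i.2
    refine ⟨by positivity, ?_⟩
    rw [← mul_div_assoc, div_le_iff₀ hn]
    nlinarith [Real.pi_pos]
  intro i j h
  simp only [cosFam, cosSeq] at h
  push_cast at h
  have h' := Real.injOn_cos (hang i) (hang j) (mul_left_cancel₀ two_ne_zero h)
  have := mul_right_cancel₀ (by positivity) h'
  ext
  exact_mod_cast add_right_cancel this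

lemma map_cosPoly (n : ℕ) :
    (cosPoly n).map (Int.castRingHom ℝ) = ∏ i, (X - C (cosFam n i)) := by
  have hm := cosPoly_monic_natDegree n
  refine eq_of_monic_of_dvd_of_natDegree_le (monic_prod_of_monic Finset.univ
    (fun i => X - C (cosFam n i)) fun i _ => monic_X_sub_C _) (hm.1.map _) ?_ ?_
  · refine Finset.prod_dvd_of_coprime
      (fun i _ j _ hij => pairwise_coprime_X_sub_C (cosFam_injective n) hij) fun i _ => ?_
    rw [dvd_iff_isRoot, IsRoot.def, eval_map, ← algebraMap_int_eq, ← aeval_def, aeval_cosFam]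
  · rw [hm.1.natDegree_map, hm.2, natDegree_prod_of_monic _ _ fun i _ => monic_X_sub_C _]
    simp

lemma prod_eval_cosPoly (n : ℕ) (z : ℤ) :
    (((cosPoly n).eval z : ℤ) : ℝ) = ∏ i, ((z : ℝ) - cosFam n i) := by
  have h := congrArg (eval (z : ℝ)) (map_cosPoly n)
  rw [eval_prod] at h
  simp only [eval_sub, eval_X, eval_C] at h
  rw [← h, eval_intCast_map]
  simp

lemma eval_neg_two_cosPoly (n : ℕ) : (cosPoly n).eval (-2) = (-1) ^ n := by
  induction n using Nat.twoStepInduction with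
  | zero => simp [cosPoly]
  | one => simp [cosPoly]
  | more n ih1 ih2 =>
    rw [cosPoly, eval_sub, eval_mul, eval_X, ih1, ih2]
    ring

lemma prod_two_add_cosFam (n : ℕ) : ∏ i, (2 + cosFam n i) = 1 := by
  have h := prod_eval_cosPoly n (-2)
  rw [eval_neg_two_cosPoly] at h
  have e : ∀ i, (((-2 : ℤ) : ℝ) - cosFam n i) = -1 * (2 + cosFam n i) := fun i => by
    push_cast; ring
  simp only [e, Finset.prod_mul_distrib, Finset.prod_const, Finset.card_univ,
    Fintype.card_fin] at h
  push_cast at h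
  have h1 : ((-1 : ℝ) ^ n) ≠ 0 := by positivity
  exact (mul_left_cancel₀ h1 (by rw [mul_one]; exact h)).symm

lemma coeff_zero_cosPoly (n : ℕ) : (cosPoly n).coeff 0 = (-1) ^ (n / 2) := by
  induction n using Nat.twoStepInduction with
  | zero => simp [cosPoly]
  | one => simp [cosPoly]
  | more n ih1 _ =>
    rw [cosPoly, coeff_sub, coeff_X_mul_zero, ih1, Nat.add_div_right n two_pos, pow_succ]
    ring

lemma coeff_succ_cosPoly (n k : ℕ) : (cosPoly (n + 2)).coeff (k + 1) =
    (cosPoly (n + 1)).coeff k - (cosPoly n).coeff (k + 1) := by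
  rw [cosPoly, coeff_sub, coeff_X_mul]

lemma prod_cosFam_eq (n : ℕ) : ∏ i, cosFam n i = (-1) ^ n * (-1) ^ (n / 2) := by
  have h := prod_eval_cosPoly n 0
  rw [← coeff_zero_eq_eval_zero, coeff_zero_cosPoly] at h
  have e : ∀ i, (((0 : ℤ) : ℝ) - cosFam n i) = -1 * cosFam n i := fun i => by
    push_cast; ring
  simp only [e, Finset.prod_mul_distrib, Finset.prod_const, Finset.card_univ,
    Fintype.card_fin] at h
  push_cast at h
  rw [h, ← mul_assoc, ← mul_pow]
  simp

lemma cosFam_ne_zero (n : ℕ) (i : Fin n) : cosFam n i ≠ 0 := by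
  have h : ∏ i, cosFam n i ≠ 0 := by
    rw [prod_cosFam_eq]; positivity
  exact Finset.prod_ne_zero_iff.1 h i (Finset.mem_univ i)

/-- The elementary symmetric functions of the inverses of `2 cos (2πk / (2n+1))`. -/
lemma coeff_prod_one_sub_inv (n k : ℕ) :
    (∏ i, (1 + C (-(cosFam n i)⁻¹) * X)).coeff k =
      (((-1) ^ (n / 2) * (cosPoly n).coeff k : ℤ) : ℝ) := by
  have h : (cosPoly n).map (Int.castRingHom ℝ) =
      C ((-1) ^ (n / 2)) * ∏ i, (1 + C (-(cosFam n i)⁻¹) * X) := by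
    have h0 : ((-1 : ℝ) ^ (n / 2)) = ∏ i, (-cosFam n i) := by
      have h := prod_eval_cosPoly n 0
      rw [← coeff_zero_eq_eval_zero, coeff_zero_cosPoly] at h
      push_cast at h
      simpa using h
    rw [map_cosPoly, h0, map_prod, ← Finset.prod_mul_distrib]
    refine Finset.prod_congr rfl fun i _ => ?_
    have : C (cosFam n i) * C (cosFam n i)⁻¹ = 1 := by
      rw [← C_mul, mul_inv_cancel₀ (cosFam_ne_zero n i), C_1]
    rw [C_neg, C_neg]
    linear_combination (-X) * this
  have h2 := congrArg (fun p : ℝ[X] => coeff p k) h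
  simp only [coeff_map, coeff_C_mul, eq_intCast] at h2
  push_cast
  rw [h2, ← mul_assoc, ← mul_pow]
  simp

@[to_additive]
lemma prod_powersetCard_succ_insert {ι R : Type*} [DecidableEq ι] [CommMonoid R] {a : ι}
    {s : Finset ι} (ha : a ∉ s) (k : ℕ) (f : Finset ι → R) :
    ∏ u ∈ (insert a s).powersetCard (k + 1), f u =
      (∏ u ∈ s.powersetCard (k + 1), f u) * ∏ u ∈ s.powersetCard k, f (insert a u) := by
  rw [Finset.powersetCard_succ_insert ha, Finset.prod_union, Finset.prod_image]
  · intro u hu v hv h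
    have hu' : a ∉ u := fun h => ha ((Finset.mem_powersetCard.1 hu).1 h)
    have hv' : a ∉ v := fun h => ha ((Finset.mem_powersetCard.1 hv).1 h)
    rw [← Finset.erase_insert hu', h, Finset.erase_insert hv']
  · rw [Finset.disjoint_left]
    intro u hu hu'
    obtain ⟨v, -, rfl⟩ := Finset.mem_image.1 hu'
    exact ha ((Finset.mem_powersetCard.1 hu).1 (Finset.mem_insert_self a v))

section

variable {ι R : Type*} [CommRing R]

/-- The elementary symmetric functions of a finite family. -/
def finsetEsymm (x : ι → R) (s : Finset ι) (k : ℕ) : R := ∑ u ∈ s.powersetCard k, ∏ i ∈ u, x i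

lemma finsetEsymm_zero (x : ι → R) (s : Finset ι) : finsetEsymm x s 0 = 1 := by
  simp [finsetEsymm]

lemma finsetEsymm_empty (x : ι → R) (k : ℕ) : finsetEsymm x ∅ (k + 1) = 0 := by
  rw [finsetEsymm, Finset.powersetCard_eq_empty.2 (by simp), Finset.sum_empty]

variable [DecidableEq ι]

lemma finsetEsymm_insert (x : ι → R) {a : ι} {s : Finset ι} (ha : a ∉ s) (k : ℕ) :
    finsetEsymm x (insert a s) (k + 1) = finsetEsymm x s (k + 1) + x a * finsetEsymm x s k := by
  rw [finsetEsymm, sum_powersetCard_succ_insert ha, finsetEsymm, finsetEsymm, Finset.mul_sum]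
  congr 1
  refine Finset.sum_congr rfl fun u hu => ?_
  rw [Finset.prod_insert fun h => ha ((Finset.mem_powersetCard.1 hu).1 h)]

lemma prod_pairs_insert (x : ι → R) {a : ι} {s : Finset ι} (ha : a ∉ s) (F : R → R) :
    ∏ u ∈ (insert a s).powersetCard 2, F (∏ i ∈ u, x i) =
      (∏ u ∈ s.powersetCard 2, F (∏ i ∈ u, x i)) * ∏ i ∈ s, F (x a * x i) := by
  rw [prod_powersetCard_succ_insert ha, Finset.powersetCard_one, Finset.prod_map]
  congr 1
  refine Finset.prod_congr rfl fun i hi => ?_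
  have : a ∉ ({i} : Finset ι) := by
    rw [Finset.mem_singleton]; rintro rfl; exact ha hi
  simp only [Function.Embedding.coeFn_mk]
  rw [Finset.prod_insert this, Finset.prod_singleton]

lemma coeff_prod_one_add (x : ι → R) (s : Finset ι) (k : ℕ) :
    (∏ i ∈ s, (1 + C (x i) * X)).coeff k = finsetEsymm x s k := by
  induction s using Finset.induction_on generalizing k with
  | empty =>
    rcases k with _ | k
    · simp [finsetEsymm_zero]
    · simp [finsetEsymm_empty, coeff_one]
  | insert a s ha ih =>
    rw [Finset.prod_insert ha, add_mul, one_mul, mul_assoc, coeff_add, coeff_C_mul]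
    rcases k with _ | k
    · rw [coeff_X_mul_zero, ih, finsetEsymm_zero, finsetEsymm_zero]; ring
    · rw [coeff_X_mul, ih, ih, finsetEsymm_insert x ha]

lemma exists_prod_one_add_four_mul (x : ι → R) (y : R) (s : Finset ι) :
    ∃ h, ∏ i ∈ s, (1 + 4 * (y * x i)) =
      1 + 4 * (y * finsetEsymm x s 1) + 16 * (y ^ 2 * finsetEsymm x s 2) + 64 * h := by
  induction s using Finset.induction_on with
  | empty => exact ⟨0, by simp [finsetEsymm_empty]⟩
  | insert a s ha ih =>
    obtain ⟨h, hh⟩ := ih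
    refine ⟨h + 4 * (y * x a) * h + (y * x a) * (y ^ 2 * finsetEsymm x s 2), ?_⟩
    rw [Finset.prod_insert ha, hh, finsetEsymm_insert x ha, finsetEsymm_insert x ha,
      finsetEsymm_zero]
    ring

lemma exists_prod_pairs_eq (x : ι → R) (s : Finset ι) :
    ∃ h, ∏ u ∈ s.powersetCard 2, (1 + 4 * ∏ i ∈ u, x i) =
      1 + 4 * finsetEsymm x s 2 +
        16 * (finsetEsymm x s 1 * finsetEsymm x s 3 - finsetEsymm x s 4) + 64 * h := by
  induction s using Finset.induction_on with
  | empty =>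
    refine ⟨0, ?_⟩
    have : (∅ : Finset ι).powersetCard 2 = ∅ := rfl
    simp [finsetEsymm_empty, this]
  | insert a s ha ih =>
    obtain ⟨h, hh⟩ := ih
    obtain ⟨h', hh'⟩ := exists_prod_one_add_four_mul x (x a) s
    rw [prod_pairs_insert x ha (fun y => 1 + 4 * y), hh, hh', finsetEsymm_insert x ha,
      finsetEsymm_insert x ha, finsetEsymm_insert x ha, finsetEsymm_insert x ha, finsetEsymm_zero]
    set e1 := finsetEsymm x s 1
    set e2 := finsetEsymm x s 2
    set e3 := finsetEsymm x s 3
    set e4 := finsetEsymm x s 4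
    refine ⟨h * (1 + 4 * (x a * e1) + 16 * (x a ^ 2 * e2) + 64 * h') +
      (1 + 4 * e2 + 16 * (e1 * e3 - e4)) * h' + (e1 * e3 - e4) * (x a * e1) +
      4 * (e1 * e3 - e4) * (x a ^ 2 * e2) + e2 * (x a ^ 2 * e2), ?_⟩
    ring

lemma prod_pairs_prod_mul (x : ι → R) (s : Finset ι) :
    (∏ u ∈ s.powersetCard 2, ∏ i ∈ u, x i) * ∏ i ∈ s, x i = (∏ i ∈ s, x i) ^ s.card := by
  induction s using Finset.induction_on with
  | empty =>
    have : (∅ : Finset ι).powersetCard 2 = ∅ := rfl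
    simp [this]
  | insert a s ha ih =>
    rw [prod_pairs_insert x ha (fun y => y), Finset.prod_insert ha, Finset.prod_mul_distrib,
      Finset.prod_const, Finset.card_insert_of_notMem ha, pow_succ, mul_pow, ← ih]
    ring

lemma prod_prod_four_add_mul (x : ι → R) (s : Finset ι) :
    ∏ i ∈ s, ∏ j ∈ s, (4 + x i * x j) =
      (∏ i ∈ s, (4 + x i ^ 2)) * (∏ u ∈ s.powersetCard 2, (4 + ∏ i ∈ u, x i)) ^ 2 := by
  induction s using Finset.induction_on with
  | empty =>
    have : (∅ : Finset ι).powersetCard 2 = ∅ := rfl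
    simp [this]
  | insert a s ha ih =>
    have e : ∀ i, ∏ j ∈ insert a s, (4 + x i * x j) =
        (4 + x a * x i) * ∏ j ∈ s, (4 + x i * x j) := fun i => by
      rw [Finset.prod_insert ha, mul_comm (x i)]
    rw [prod_pairs_insert x ha (fun y => 4 + y), Finset.prod_insert ha, Finset.prod_congr rfl
      fun i _ => e i, Finset.prod_insert ha, Finset.prod_mul_distrib, ih, Finset.prod_insert ha]
    ring

end

lemma isSymmetric_prod_pairs (n : ℕ) :
    (∏ u ∈ (Finset.univ : Finset (Fin n)).powersetCard 2,
      (1 + 4 * ∏ i ∈ u, (MvPolynomial.X i : MvPolynomial (Fin n) ℤ))).IsSymmetric := by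
  intro e
  have h4 : MvPolynomial.rename e (4 : MvPolynomial (Fin n) ℤ) = 4 := map_ofNat _ 4
  rw [map_prod]
  simp only [map_add, map_one, map_mul, map_prod, MvPolynomial.rename_X, h4]
  conv_rhs => rw [← Finset.map_univ_equiv e, Finset.powersetCard_map, Finset.prod_map]
  refine Finset.prod_congr rfl fun u _ => ?_
  simp [Finset.mapEmbedding_apply]

/-- The expansion modulo 64 of `∏ (1 + 4 t_i t_j)` in integral elementary symmetric functions. -/
theorem exists_int_prod_pairs {n : ℕ} {t : Fin n → ℝ} {d : ℕ → ℤ}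
    (hd : ∀ k, finsetEsymm t Finset.univ k = d k) :
    ∃ z : ℤ, ∏ u ∈ (Finset.univ : Finset (Fin n)).powersetCard 2, (1 + 4 * ∏ i ∈ u, t i) =
      ((1 + 4 * d 2 + 16 * (d 1 * d 3 - d 4) + 64 * z : ℤ) : ℝ) := by
  obtain ⟨h, hh⟩ := exists_prod_pairs_eq (MvPolynomial.X : Fin n → MvPolynomial (Fin n) ℤ)
    Finset.univ
  have hes : ∀ k, (finsetEsymm (MvPolynomial.X : Fin n → MvPolynomial (Fin n) ℤ)
      Finset.univ k) = MvPolynomial.esymm (Fin n) ℤ k := fun k => rfl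
  simp only [hes] at hh
  have hev : ∀ k, MvPolynomial.aeval t (MvPolynomial.esymm (Fin n) ℤ k) = (d k : ℝ) := by
    intro k
    rw [← hd, ← hes, finsetEsymm, finsetEsymm, map_sum]
    simp [map_prod]
  have hsymm : h.IsSymmetric := by
    intro e
    have h64 : MvPolynomial.rename e (64 : MvPolynomial (Fin n) ℤ) = 64 := map_ofNat _ 64
    have h16 : MvPolynomial.rename e (16 : MvPolynomial (Fin n) ℤ) = 16 := map_ofNat _ 16
    have h4 : MvPolynomial.rename e (4 : MvPolynomial (Fin n) ℤ) = 4 := map_ofNat _ 4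
    have h1 := isSymmetric_prod_pairs n e
    rw [hh] at h1
    simp only [map_add, map_mul, map_sub, map_one, h64, h16, h4, MvPolynomial.rename_esymm] at h1
    exact mul_left_cancel₀ (by norm_num : (64 : MvPolynomial (Fin n) ℤ) ≠ 0)
      (add_left_cancel h1)
  obtain ⟨q, hq⟩ := MvPolynomial.esymmAlgHom_surjective ℤ (Fintype.card_fin n).le ⟨h, hsymm⟩
  have hq' := congrArg Subtype.val hq
  rw [MvPolynomial.esymmAlgHom_apply] at hq'
  refine ⟨MvPolynomial.aeval (fun i : Fin n => d (i + 1)) q, ?_⟩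
  have hz : MvPolynomial.aeval t h =
      ((MvPolynomial.aeval (fun i : Fin n => d (i + 1)) q : ℤ) : ℝ) := by
    have h1 : h = MvPolynomial.aeval (fun i : Fin n => MvPolynomial.esymm (Fin n) ℤ (i + 1)) q :=
      hq'.symm
    rw [h1, MvPolynomial.comp_aeval_apply]
    simp only [hev]
    exact (MvPolynomial.aeval_algebraMap_apply ℝ (fun i : Fin n => d (i + 1)) q)
  have hG := congrArg (MvPolynomial.aeval t) hh
  simp only [map_prod, map_add, map_mul, map_sub, map_one, map_ofNat, MvPolynomial.aeval_X, hev,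
    hz] at hG
  rw [hG]
  push_cast
  ring

/-- One step of the recursion for the five lowest coefficients of two consecutive polynomials. -/
def coeffStep (s : (ℤ × ℤ × ℤ × ℤ × ℤ) × (ℤ × ℤ × ℤ × ℤ × ℤ)) :
    (ℤ × ℤ × ℤ × ℤ × ℤ) × (ℤ × ℤ × ℤ × ℤ × ℤ) :=
  match s with
  | ((a0, a1, a2, a3, a4), (b0, b1, b2, b3, b4)) =>
    ((b0, b1, b2, b3, b4), (-a0, b0 - a1, b1 - a2, b2 - a3, b3 - a4))

/-- The five lowest coefficients of a polynomial. -/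
def lowCoeffs (p : ℤ[X]) : ℤ × ℤ × ℤ × ℤ × ℤ :=
  (p.coeff 0, p.coeff 1, p.coeff 2, p.coeff 3, p.coeff 4)

lemma lowCoeffs_cosPoly (n : ℕ) :
    (lowCoeffs (cosPoly n), lowCoeffs (cosPoly (n + 1))) =
      coeffStep^[n] ((1, 0, 0, 0, 0), (1, 1, 0, 0, 0)) := by
  induction n with
  | zero => simp [lowCoeffs, cosPoly, coeff_one, coeff_X]
  | succ n ih =>
    rw [Function.iterate_succ_apply', ← ih]
    simp only [lowCoeffs, coeffStep, coeff_succ_cosPoly]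
    rw [cosPoly, coeff_sub, coeff_X_mul_zero, zero_sub]

lemma lowCoeffs_cosPoly_33 : lowCoeffs (cosPoly 33) = (1, 17, -136, -816, 3060) := by
  have h : coeffStep^[33] ((1, 0, 0, 0, 0), (1, 1, 0, 0, 0)) =
      ((1, 17, -136, -816, 3060), (-1, 17, 153, -816, -3876)) := by decide +kernel
  exact congrArg Prod.fst ((lowCoeffs_cosPoly 33).trans h)

lemma lowCoeffs_cosPoly_64 : lowCoeffs (cosPoly 64) = (1, -32, -528, 5456, 46376) ∧
    lowCoeffs (cosPoly 65) = (1, 33, -528, -5984, 46376) := by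
  have h : coeffStep^[64] ((1, 0, 0, 0, 0), (1, 1, 0, 0, 0)) =
      ((1, -32, -528, 5456, 46376), (1, 33, -528, -5984, 46376)) := by decide +kernel
  have h' := (lowCoeffs_cosPoly 64).trans h
  rw [Prod.mk.injEq] at h'
  exact h'

/-- A shift that is a period of the low coefficients for two consecutive indices is a period. -/
lemma coeff_cosPoly_add_modEq {M : ℤ} {p K : ℕ}
    (h0 : ∀ k ≤ K, (cosPoly p).coeff k ≡ (cosPoly 0).coeff k [ZMOD M])
    (h1 : ∀ k ≤ K, (cosPoly (1 + p)).coeff k ≡ (cosPoly 1).coeff k [ZMOD M]) (n : ℕ) :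
    ∀ k ≤ K, (cosPoly (n + p)).coeff k ≡ (cosPoly n).coeff k [ZMOD M] := by
  induction n using Nat.twoStepInduction with
  | zero => simpa using h0
  | one => exact h1
  | more n ih1 ih2 =>
    intro k hk
    have e : n + 2 + p = n + p + 2 := by ring
    have e' : n + p + 1 = n + 1 + p := by ring
    rw [e]
    rcases k with _ | k
    · rw [cosPoly, cosPoly, coeff_sub, coeff_sub, coeff_X_mul_zero, coeff_X_mul_zero]
      exact (Int.ModEq.refl 0).sub (ih1 0 hk)
    · rw [coeff_succ_cosPoly, coeff_succ_cosPoly, e']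
      exact (ih2 k (by omega)).sub (ih1 (k + 1) hk)

lemma coeff_cosPoly_period_sixteen (n : ℕ) :
    ∀ k ≤ 2, (cosPoly (n + 64)).coeff k ≡ (cosPoly n).coeff k [ZMOD 16] := by
  obtain ⟨h, h'⟩ := lowCoeffs_cosPoly_64
  simp only [lowCoeffs, Prod.mk.injEq] at h h'
  refine coeff_cosPoly_add_modEq ?_ ?_ n <;> intro k hk <;> interval_cases k <;>
    simp only [Nat.reduceAdd, h, h'] <;> simp [cosPoly, coeff_one, coeff_X] <;> decide

lemma coeff_cosPoly_period_four (n : ℕ) :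
    ∀ k ≤ 4, (cosPoly (n + 64)).coeff k ≡ (cosPoly n).coeff k [ZMOD 4] := by
  obtain ⟨h, h'⟩ := lowCoeffs_cosPoly_64
  simp only [lowCoeffs, Prod.mk.injEq] at h h'
  refine coeff_cosPoly_add_modEq ?_ ?_ n <;> intro k hk <;> interval_cases k <;>
    simp only [Nat.reduceAdd, h, h'] <;> simp [cosPoly, coeff_one, coeff_X] <;> decide

/-- The coefficients of the normalised reversal of `cosPoly n`. -/
noncomputable def invCoeff (n k : ℕ) : ℤ := (-1) ^ (n / 2) * (cosPoly n).coeff k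

/-- The explicit value modulo 64 of the square root of the odd part of the dimer count. -/
noncomputable def rootResidue (n : ℕ) : ℤ :=
  ((-1) ^ n * (-1) ^ (n / 2)) ^ (n + 1) *
    (1 + 4 * invCoeff n 2 + 16 * (invCoeff n 1 * invCoeff n 3 - invCoeff n 4))

lemma rootResidue_add (n : ℕ) : rootResidue (n + 64) ≡ rootResidue n [ZMOD 64] := by
  have hs : (-1 : ℤ) ^ ((n + 64) / 2) = (-1) ^ (n / 2) := by
    rw [show (n + 64) / 2 = n / 2 + 32 by omega, pow_add]; norm_num
  have hd : ((-1 : ℤ) ^ (n + 64) * (-1) ^ ((n + 64) / 2)) ^ (n + 64 + 1) =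
      ((-1) ^ n * (-1) ^ (n / 2)) ^ (n + 1) := by
    have h1 : ((-1 : ℤ) ^ n * (-1) ^ (n / 2)) ^ 64 = 1 := by
      rw [← pow_add, ← pow_mul, mul_comm, pow_mul]; norm_num
    rw [hs, pow_add (-1) n 64, show n + 64 + 1 = n + 1 + 64 by ring]
    norm_num [pow_add _ (n + 1) 64, h1]
  rw [rootResidue, rootResidue, hd]
  refine Int.ModEq.mul_left _ ?_
  have hc : ∀ k ≤ 4, invCoeff (n + 64) k ≡ invCoeff n k [ZMOD 4] := fun k hk => by
    rw [invCoeff, invCoeff, hs]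
    exact (coeff_cosPoly_period_four n k hk).mul_left _
  have h2 : invCoeff (n + 64) 2 ≡ invCoeff n 2 [ZMOD 16] := by
    rw [invCoeff, invCoeff, hs]
    exact (coeff_cosPoly_period_sixteen n 2 le_rfl).mul_left _
  have h4 := ((hc 1 (by norm_num)).mul (hc 3 (by norm_num))).sub (hc 4 le_rfl)
  exact ((Int.ModEq.refl 1).add (h2.mul_left' (c := 4))).add (h4.mul_left' (c := 16))

lemma rootResidue_one : rootResidue 1 = 1 := by
  simp [rootResidue, invCoeff, cosPoly, coeff_one, coeff_X]

lemma rootResidue_33 : rootResidue 33 ≡ 33 [ZMOD 64] := by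
  have h := lowCoeffs_cosPoly_33
  simp only [lowCoeffs, Prod.mk.injEq] at h
  simp only [rootResidue, invCoeff, h]
  decide +kernel

/-- The positive square root of `dimerCount n / 2 ^ n`. -/
noncomputable def dimerRoot (n : ℕ) : ℝ :=
  ∏ u ∈ (Finset.univ : Finset (Fin n)).powersetCard 2, (4 + ∏ i ∈ u, cosFam n i)

lemma dimerRoot_pos (n : ℕ) : 0 < dimerRoot n := by
  refine Finset.prod_pos fun u hu => ?_
  obtain ⟨i, j, hij, rfl⟩ := Finset.card_eq_two.1 (Finset.mem_powersetCard.1 hu).2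
  rw [Finset.prod_pair hij]
  have h : |cosFam n i * cosFam n j| < 2 * 2 := by
    rw [abs_mul]
    exact mul_lt_mul'' (abs_cosFam_lt n i) (abs_cosFam_lt n j) (abs_nonneg _) (abs_nonneg _)
  have := (abs_lt.1 h).1
  linarith

lemma dimerCount_eq_dimerRoot (n : ℕ) : (dimerCount n : ℝ) = 2 ^ n * dimerRoot n ^ 2 := by
  have h := prod_pairs_relation n
  rw [← dimerCount_eq_prod, prod_prod_four_add_mul (cosFam n) Finset.univ, prod_four_add_sq] at h
  have hU : ∏ i, (4 + 2 * cosFam n i) = 2 ^ n := by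
    have e : ∀ i, 4 + 2 * cosFam n i = 2 * (2 + cosFam n i) := fun i => by ring
    simp only [e, Finset.prod_mul_distrib, prod_two_add_cosFam, mul_one, Finset.prod_const,
      Finset.card_univ, Fintype.card_fin]
  have hW : ∏ i, (6 + cosFam n i) ≠ 0 := (Finset.prod_pos fun i _ => by
    have := (abs_lt.1 (abs_cosFam_lt n i)).1
    linarith).ne'
  rw [hU] at h
  refine mul_left_cancel₀ hW ?_
  rw [← h, dimerRoot]
  ring

lemma exists_dimerRoot_eq (n : ℕ) : ∃ z : ℤ, dimerRoot n = z ∧ z ≡ rootResidue n [ZMOD 64] := by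
  obtain ⟨z, hz⟩ := exists_int_prod_pairs (n := n) (t := fun i => -(cosFam n i)⁻¹)
    (d := invCoeff n) (fun k => by rw [← coeff_prod_one_add, coeff_prod_one_sub_inv, invCoeff])
  have hsplit : dimerRoot n =
      (∏ u ∈ (Finset.univ : Finset (Fin n)).powersetCard 2, ∏ i ∈ u, cosFam n i) *
      ∏ u ∈ (Finset.univ : Finset (Fin n)).powersetCard 2, (1 + 4 * ∏ i ∈ u, -(cosFam n i)⁻¹) := by
    rw [dimerRoot, ← Finset.prod_mul_distrib]
    refine Finset.prod_congr rfl fun u hu => ?_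
    obtain ⟨i, j, hij, rfl⟩ := Finset.card_eq_two.1 (Finset.mem_powersetCard.1 hu).2
    simp only [Finset.prod_pair hij]
    have := cosFam_ne_zero n i
    have := cosFam_ne_zero n j
    field_simp
    ring
  have hpairs : ∏ u ∈ (Finset.univ : Finset (Fin n)).powersetCard 2, ∏ i ∈ u, cosFam n i =
      ((-1) ^ n * (-1) ^ (n / 2)) ^ (n + 1) := by
    have h := prod_pairs_prod_mul (cosFam n) Finset.univ
    rw [prod_cosFam_eq, Finset.card_univ, Fintype.card_fin] at h
    have h1 : ((-1 : ℝ) ^ n * (-1) ^ (n / 2)) * ((-1) ^ n * (-1) ^ (n / 2)) = 1 := by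
      rw [← pow_add, ← mul_pow]; norm_num
    rw [pow_succ, ← h, mul_assoc, h1, mul_one]
  refine ⟨((-1) ^ n * (-1) ^ (n / 2)) ^ (n + 1) * (1 + 4 * invCoeff n 2 +
    16 * (invCoeff n 1 * invCoeff n 3 - invCoeff n 4) + 64 * z), ?_, ?_⟩
  · rw [hsplit, hpairs, hz]
    push_cast
    ring
  · rw [rootResidue]
    refine Int.ModEq.mul_left _ ?_
    exact Int.modEq_add_fac_self

theorem corollary2 :
    ∃ B : ℕ → ℤ,
      (∀ n : ℕ, 1 ≤ n → 0 < B n ∧ (dimerCount n : ℤ) = 2 ^ n * B n ^ 2) ∧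
      IsLeast {p : ℕ | 0 < p ∧ ∀ n : ℕ, 1 ≤ n → B (n + p) ≡ B n [ZMOD 64]} 64 := by
  choose B hB hmod using exists_dimerRoot_eq
  have hper : ∀ n, B (n + 64) ≡ B n [ZMOD 64] := fun n =>
    ((hmod _).trans (rootResidue_add n)).trans (hmod n).symm
  refine ⟨B, fun n _ => ⟨?_, ?_⟩, ⟨by norm_num, fun n _ => hper n⟩, ?_⟩
  · have := dimerRoot_pos n
    rw [hB] at this
    exact_mod_cast this
  · have := dimerCount_eq_dimerRoot n
    rw [hB] at this
    exact_mod_cast this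
  · rintro p ⟨hp, hpB⟩
    by_contra! hlt
    obtain ⟨t, s, hts⟩ : ∃ t s, t * p = 32 + 64 * s := by
      have h : ∀ p < 64, 0 < p → ∃ t < 64, ∃ s < 64, t * p = 32 + 64 * s := by decide +kernel
      obtain ⟨t, -, s, -, h⟩ := h p hlt hp
      exact ⟨t, s, h⟩
    have h1 : ∀ t, B (1 + t * p) ≡ B 1 [ZMOD 64] := by
      intro t
      induction t with
      | zero => simp
      | succ t ih =>
        rw [Nat.succ_mul, ← add_assoc]
        exact (hpB _ (by omega)).trans ih
    have h2 : ∀ s, B (33 + 64 * s) ≡ B 33 [ZMOD 64] := by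
      intro s
      induction s with
      | zero => simp
      | succ s ih =>
        rw [Nat.mul_succ, ← add_assoc]
        exact (hper _).trans ih
    have h3 := h1 t
    rw [hts, ← add_assoc] at h3
    have h4 : (33 : ℤ) ≡ 1 [ZMOD 64] := by
      have h5 := hmod 1
      rw [rootResidue_one] at h5
      exact (rootResidue_33.symm.trans ((hmod 33).symm.trans ((h2 s).symm.trans h3))).trans h5
    exact absurd h4 (by decide)
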